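/- Let $U\subset\mathbb{R}^m$ and $D\subset\mathbb{R}^w$ be nonempty and compact, and let $f:\mathbb{R}^n\times U\times D\to\mathbb{R}^n$ be bounded, Lipschitz continuous in the state $x$ uniformly in $(u,d)\in U\times D$, and continuous in $(u,d)$ for each $x$. Let $l:\mathbb{R}^n\to\mathbb{R}$ be bounded and Lipschitz continuous, and let $\gamma\ge 0$. For $t\le 0$ let $\mathcal{U}_{[t,0]}$ and $\mathcal{D}_{[t,0]}$ be the sets of Lebesgue measurable functions from $[t,0]$ to $U$ and $D$. Let $\Xi_{[t,0]}$ be the set of nonanticipative strategies, that is, of maps $\xi:\mathcal{U}_{[t,0]}\to\mathcal{D}_{[t,0]}$ such that for all $s\in[t,0]$ and $u,\hat u\in\mathcal{U}_{[t,0]}$, if $u=\hat u$ a.e. on $[t,s]$, then $\xi[u]=\xi[\hat u]$ a.e. on $[t,s]$. For $x\in\mathbb{R}^n$, $u\in\mathcal{U}_{[t,0]}$, $d\in\mathcal{D}_{[t,0]}$ let $\mathrm{x}_{x,t}^{u,d}:[t,0]\to\mathbb{R}^n$ be the (unique, absolutely continuous) solution of $\dot{\mathrm{x}}(s)=f(\mathrm{x}(s),u(s),d(s))$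 for a.e. $s\in[t,0]$, $\mathrm{x}(t)=x$. The robust control barrier-value function is $$B_\gamma(x,t)=\inf_{\xi\in\Xi_{[t,0]}}\ \sup_{u\in\mathcal{U}_{[t,0]}}\ \min_{s\in[t,0]} e^{\gamma(s-t)}\, l\bigl(\mathrm{x}_{x,t}^{u,\xi[u]}(s)\bigr),\qquad x\in\mathbb{R}^n,\ t\le 0 .$$ Then $B_\gamma$ is Lipschitz continuous on $\mathbb{R}^n\times[T,0]$ for every $T\le 0$. It satisfies the terminal condition $B_\gamma(x,0)=l(x)$ for all $x\in\mathbb{R}^n$, and it is a viscosity solution on $\mathbb{R}^n\times(-\infty,0)$ of the variational inequality $$0=\min\Bigl\{\,l(x)-B(x,t),\ D_tB(x,t)+\max_{u\in U}\min_{d\in D}D_xB(x,t)\cdot f(x,u,d)+\gamma B(x,t)\Bigr\}.$$ It is the only viscosity solution $B$ with $B(\cdot,0)=l$. Here a viscosity solution is a continuous function $B:\mathbb{R}^n\times(-\infty,0]\to\mathbb{R}$ such that for every $C^1$ function $\phi$ and every $(x_0,t_0)\in\mathbb{R}^n\times(-\infty,0)$, the quantity $$\min\Bigl\{\,l(x_0)-\phi(x_0,t_0),\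 D_t\phi(x_0,t_0)+\max_{u\in U}\min_{d\in D}D_x\phi(x_0,t_0)\cdot f(x_0,u,d)+\gamma\phi(x_0,t_0)\Bigr\}$$ is $\ge 0$ if $B-\phi$ has a local maximum with value $0$ at $(x_0,t_0)$, and is $\le 0$ if $B-\phi$ has a local minimum with value $0$ at $(x_0,t_0)$. -/

import Mathlib

open Set MeasureTheory

noncomputable section

namespace CBVF

/-- `ℝᵏ` with its Euclidean norm. -/
abbrev E (k : ℕ) : Type := EuclideanSpace ℝ (Fin k)

variable {n m w : ℕ}

/-- The Lebesgue measurable signals on the time interval `[t, 0]` with values in `V`. Signals are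
represented by functions on `ℝ` whose values outside `[t, 0]` play no role. -/
def Signal {k : ℕ} (V : Set (E k)) (t : ℝ) : Type :=
  {u : ℝ → E k // AEMeasurable u (volume.restrict (Icc t 0)) ∧ ∀ s ∈ Icc t 0, u s ∈ V}

/-- `ξ` is nonanticipative: if two controls agree a.e. on `[t, s]`, then so do the responses.
For `s = 0` this says in particular that `ξ` only sees the restriction of a control to `[t, 0]`. -/
def Nonanticipative {U : Set (E m)} {D : Set (E w)} {t : ℝ} (ξ : Signal U t → Signal D t) : Prop :=
  ∀ u v : Signal U t, ∀ s ∈ Icc t 0,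
    (∀ᵐ τ ∂(volume.restrict (Icc t s)), u.1 τ = v.1 τ) →
      ∀ᵐ τ ∂(volume.restrict (Icc t s)), (ξ u).1 τ = (ξ v).1 τ

/-- The nonanticipative disturbance strategies on `[t, 0]`. -/
def Strategy (U : Set (E m)) (D : Set (E w)) (t : ℝ) : Type :=
  {ξ : Signal U t → Signal D t // Nonanticipative ξ}

/-- `y` solves `ẏ(s) = f (y s) (u s) (d s)` for a.e. `s ∈ [t, 0]`, `y t = x` (Carathéodory
solution, in the equivalent integrated form). -/
def IsTrajectory (f : E n → E m → E w → E n) (x : E n) (t : ℝ) (u : ℝ → E m) (d : ℝ → E w)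
    (y : ℝ → E n) : Prop :=
  IntervalIntegrable (fun τ => f (y τ) (u τ) (d τ)) volume t 0 ∧
    ∀ s ∈ Icc t 0, y s = x + ∫ τ in t..s, f (y τ) (u τ) (d τ)

/-- The solution of the system for `(x, t, u, d)`. For dynamics that are bounded, Lipschitz in the
state and continuous in control and disturbance it exists and is unique on `[t, 0]`. -/
def trajectory (f : E n → E m → E w → E n) (x : E n) (t : ℝ) (u : ℝ → E m) (d : ℝ → E w) :
    ℝ → E n :=
  Classical.epsilon (IsTrajectory f x t u d)

/-- The payoff `min_{s ∈ [t, 0]} e^{γ (s - t)} l (y s)` of a path `y`. -/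
def payoff (γ : ℝ) (l : E n → ℝ) (t : ℝ) (y : ℝ → E n) : ℝ :=
  ⨅ s : Icc t 0, Real.exp (γ * ((s : ℝ) - t)) * l (y s)

/-- The robust control barrier-value function `B_γ(x, t)`. -/
def value (f : E n → E m → E w → E n) (U : Set (E m)) (D : Set (E w)) (l : E n → ℝ) (γ : ℝ)
    (x : E n) (t : ℝ) : ℝ :=
  ⨅ ξ : Strategy U D t, ⨆ u : Signal U t, payoff γ l t (trajectory f x t u.1 (ξ.1 u).1)

/-- The Hamiltonian `max_{u ∈ U} min_{d ∈ D} p · f(x, u, d)`, with the covector `p` given as a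
linear functional. -/
def hamiltonian (f : E n → E m → E w → E n) (U : Set (E m)) (D : Set (E w)) (x : E n)
    (p : E n →L[ℝ] ℝ) : ℝ :=
  ⨆ u : U, ⨅ d : D, p (f x u d)

/-- The expression `min {l - φ, D_t φ + max_u min_d D_x φ · f + γ φ}` at the point `(x, t)`. -/
def viOperator (f : E n → E m → E w → E n) (U : Set (E m)) (D : Set (E w)) (l : E n → ℝ) (γ : ℝ)
    (φ : E n × ℝ → ℝ) (x : E n) (t : ℝ) : ℝ :=
  min (l x - φ (x, t))
    (fderiv ℝ φ (x, t) (0, 1)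
      + hamiltonian f U D x ((fderiv ℝ φ (x, t)).comp (ContinuousLinearMap.inl ℝ (E n) ℝ))
      + γ * φ (x, t))

/-- Viscosity solutions of
`0 = min {l - W, D_t W + max_u min_d D_x W · f + γ W}` on `ℝⁿ × (-∞, 0)`, continuous up to the
terminal time `0`. Signs are those of a terminal value problem. -/
structure IsViscositySolution (f : E n → E m → E w → E n) (U : Set (E m)) (D : Set (E w))
    (l : E n → ℝ) (γ : ℝ) (W : E n → ℝ → ℝ) : Prop where
  continuousOn : ContinuousOn (fun p : E n × ℝ => W p.1 p.2) (univ ×ˢ Iic 0)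
  subsolution : ∀ φ : E n × ℝ → ℝ, ContDiff ℝ 1 φ → ∀ x : E n, ∀ t < 0,
    W x t - φ (x, t) = 0 → IsLocalMax (fun p : E n × ℝ => W p.1 p.2 - φ p) (x, t) →
      0 ≤ viOperator f U D l γ φ x t
  supersolution : ∀ φ : E n × ℝ → ℝ, ContDiff ℝ 1 φ → ∀ x : E n, ∀ t < 0,
    W x t - φ (x, t) = 0 → IsLocalMin (fun p : E n × ℝ => W p.1 p.2 - φ p) (x, t) →
      viOperator f U D l γ φ x t ≤ 0

end CBVF

end

/-! Existence: the value inherits a dynamic programming principle, and two one-sided special cases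
of it suffice. For an upper bound on $[t,r]$ the disturbance may answer by a static feedback
$d=c(u)$ and then switch to a nearly optimal strategy for the point reached
(`value_le_of_feedback`). For a lower bound the control may stay constant up to $r$ and then respond
nearly optimally (`le_value_of_const`). These two moves match the order of $\max_u\min_d$ in the
Hamiltonian: the minimizing $d$ may depend on $u$, while the maximizing $u$ is chosen beforehand.
Inserting a first order expansion of a test function along trajectories, uniform in the inputs,
gives both viscosity inequalities; the obstacle bound $B_\gamma\le l$ is the payoff at $s=t$. The
same two moves with constant inputs give Lipschitz continuity in time, and Gronwall's inequality
gives it in space.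

Uniqueness: $V=e^{\gamma t}W$ removes the zero order term. If $W_1>W_2$ somewhere, $V_1-V_2$ minus a
penalty $\psi$ has a positive maximum on a compact cylinder. The function $\psi$ decreases at rate
at least $\eta$ in every direction $(z,1)$ with $\|z\|\le M$, so its contribution to the inequality
has a favourable sign whatever inputs the Hamiltonian selects, and it is large enough near the
lateral and bottom boundary to keep the maximum inside (`exists_penalty`). Doubling the variables
(`exists_doubling`) then yields two viscosity inequalities with the same quadratic gradient, which
contradict each other by $\eta$ (`doubled_inequalities_false`). At such a maximum $W_1-l>W_2-l$ with
a uniform gap, so the obstacle cannot be what satisfies the supersolution inequality. -/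

namespace CBVF

/-! ### Gronwall's inequality; existence, uniqueness and stability of trajectories -/

/-- Gronwall's inequality in integral form. -/
theorem le_mul_exp_of_le_add_integral {φ : ℝ → ℝ} {a L t b : ℝ} (hφ : ContinuousOn φ (Icc t b))
    (hL : 0 ≤ L) (h : ∀ s ∈ Icc t b, φ s ≤ a + L * ∫ τ in t..s, φ τ) :
    ∀ s ∈ Icc t b, φ s ≤ a * Real.exp (L * (s - t)) := by
  intro s hs
  have htb : t ≤ b := hs.1.trans hs.2
  -- The constant extension is continuous on all of `ℝ`, so its primitive is differentiable
  -- everywhere and the differential Gronwall inequality applies to $a+L\int\psi$.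
  set ψ : ℝ → ℝ := IccExtend htb ((Icc t b).domRestrict φ) with hψ
  have hψc : Continuous ψ := (continuousOn_iff_continuous_domRestrict.1 hφ).Icc_extend'
  have hψφ : ∀ r ∈ Icc t b, ψ r = φ r := fun r hr => by
    simp [hψ, IccExtend_of_mem htb _ hr, domRestrict]
  have hint : ∀ r ∈ Icc t b, ∫ τ in t..r, ψ τ = ∫ τ in t..r, φ τ := fun r hr => by
    refine intervalIntegral.integral_congr fun τ hτ => hψφ τ ?_
    rw [uIcc_of_le hr.1] at hτ
    exact ⟨hτ.1, hτ.2.trans hr.2⟩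
  have hder : ∀ r, HasDerivAt (fun r => a + L * ∫ τ in t..r, ψ τ) (L * ψ r) r := fun r =>
    ((intervalIntegral.integral_hasDerivAt_right (hψc.intervalIntegrable _ _)
      (hψc.stronglyMeasurableAtFilter _ _) hψc.continuousAt).const_mul L).const_add a
  have key := le_gronwallBound_of_liminf_deriv_right_le (f := fun r => a + L * ∫ τ in t..r, ψ τ)
    (f' := fun r => L * ψ r) (δ := a) (K := L) (ε := 0) (a := t) (b := b)
    (fun r _ => (hder r).continuousAt.continuousWithinAt)
    (fun r _ c hc => (hder r).hasDerivWithinAt.liminf_right_slope_le hc)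
    (by simp) (fun r hr => by
      have hr' : r ∈ Icc t b := ⟨hr.1, hr.2.le⟩
      have := h r hr'
      rw [add_zero, hψφ r hr', hint r hr']
      exact mul_le_mul_of_nonneg_left this hL) s hs
  rw [gronwallBound_ε0, hint s hs] at key
  exact (h s hs).trans key

variable {n m w : ℕ}

/-- The standing assumptions on the dynamics: compact nonempty sets of inputs, uniformly Lipschitz
in the state, bounded by `M`, continuous in the inputs. -/
structure RegularDynamics (f : E n → E m → E w → E n) (U : Set (E m)) (D : Set (E w))
    (L : NNReal) (M : ℝ) : Prop where
  isCompact_left : IsCompact U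
  nonempty_left : U.Nonempty
  isCompact_right : IsCompact D
  nonempty_right : D.Nonempty
  lipschitz : ∀ u ∈ U, ∀ d ∈ D, LipschitzWith L (fun x => f x u d)
  norm_le : ∀ x, ∀ u ∈ U, ∀ d ∈ D, ‖f x u d‖ ≤ M
  continuousOn : ∀ x, ContinuousOn (fun p : E m × E w => f x p.1 p.2) (U ×ˢ D)

variable {f : E n → E m → E w → E n} {U : Set (E m)} {D : Set (E w)} {L : NNReal} {M : ℝ}
  {x : E n} {t : ℝ}

namespace RegularDynamics

theorem bound_nonneg (hf : RegularDynamics f U D L M) : 0 ≤ M := by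
  obtain ⟨u, hu⟩ := hf.nonempty_left
  obtain ⟨d, hd⟩ := hf.nonempty_right
  exact (norm_nonneg _).trans (hf.norm_le 0 u hu d hd)

theorem norm_sub_le (hf : RegularDynamics f U D L M) {u : E m} (hu : u ∈ U) {d : E w} (hd : d ∈ D)
    (x y : E n) : ‖f x u d - f y u d‖ ≤ L * ‖x - y‖ := by
  simpa [dist_eq_norm] using (hf.lipschitz u hu d hd).dist_le_mul x y

theorem continuousOn_uncurry (hf : RegularDynamics f U D L M) :
    ContinuousOn (fun p : E n × E m × E w => f p.1 p.2.1 p.2.2) (univ ×ˢ U ×ˢ D) := by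
  refine continuousOn_prod_of_continuousOn_lipschitzOnWith
    (fun p : E n × E m × E w => f p.1 p.2.1 p.2.2) L (fun x _ => hf.continuousOn x)
    (fun p hp => (hf.lipschitz p.1 hp.1 p.2 hp.2).lipschitzOnWith)

theorem aestronglyMeasurable (hf : RegularDynamics f U D L M) (u : Signal U t) (d : Signal D t)
    {y : ℝ → E n} (hy : ContinuousOn y (Icc t 0)) :
    AEStronglyMeasurable (fun τ => f (y τ) (u.1 τ) (d.1 τ)) (volume.restrict (Icc t 0)) := by
  have hS : MeasurableSet ((univ : Set (E n)) ×ˢ U ×ˢ D) :=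
    MeasurableSet.univ.prod
      (hf.isCompact_left.measurableSet.prod hf.isCompact_right.measurableSet)
  have hG : AEMeasurable (fun τ => (y τ, u.1 τ, d.1 τ)) (volume.restrict (Icc t 0)) :=
    (hy.aemeasurable measurableSet_Icc).prodMk (u.2.1.prodMk d.2.1)
  -- Nothing is assumed about `f` off `U` and `D`; cutting it off there gives a globally Borel
  -- function that agrees with `f` along the signals.
  have hF : Measurable (((univ : Set (E n)) ×ˢ U ×ˢ D).indicator
      (fun p : E n × E m × E w => f p.1 p.2.1 p.2.2)) := by
    classical
    rw [← piecewise_eq_indicator]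
    exact hf.continuousOn_uncurry.measurable_piecewise continuousOn_const hS
  refine ((hF.comp_aemeasurable hG).congr ?_).aestronglyMeasurable
  refine (ae_restrict_iff' measurableSet_Icc).2 (Filter.Eventually.of_forall fun τ hτ => ?_)
  exact indicator_of_mem (s := (univ : Set (E n)) ×ˢ U ×ˢ D)
    ⟨mem_univ _, u.2.2 τ hτ, d.2.2 τ hτ⟩ _

theorem integrableOn (hf : RegularDynamics f U D L M) (u : Signal U t) (d : Signal D t)
    {y : ℝ → E n} (hy : ContinuousOn y (Icc t 0)) :
    IntegrableOn (fun τ => f (y τ) (u.1 τ) (d.1 τ)) (Icc t 0) := by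
  refine Integrable.of_bound (hf.aestronglyMeasurable u d hy) M ?_
  exact (ae_restrict_iff' measurableSet_Icc).2 (Filter.Eventually.of_forall fun τ hτ =>
    hf.norm_le _ _ (u.2.2 τ hτ) _ (d.2.2 τ hτ))

theorem intervalIntegrable (hf : RegularDynamics f U D L M) (u : Signal U t) (d : Signal D t)
    {y : ℝ → E n} (hy : ContinuousOn y (Icc t 0)) {a b : ℝ} (ha : t ≤ a) (hab : a ≤ b)
    (hb : b ≤ 0) :
    IntervalIntegrable (fun τ => f (y τ) (u.1 τ) (d.1 τ)) volume a b := by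
  rw [intervalIntegrable_iff_integrableOn_Icc_of_le hab]
  exact (hf.integrableOn u d hy).mono_set (Icc_subset_Icc ha hb)

end RegularDynamics

namespace IsTrajectory

variable {u : ℝ → E m} {d : ℝ → E w} {y : ℝ → E n}

theorem apply_initial (h : IsTrajectory f x t u d y) (ht : t ≤ 0) : y t = x := by
  simpa using h.2 t ⟨le_rfl, ht⟩

theorem continuousOn (h : IsTrajectory f x t u d y) (ht : t ≤ 0) : ContinuousOn y (Icc t 0) := by
  have := intervalIntegral.continuousOn_primitive_interval' h.1 left_mem_uIcc
  rw [uIcc_of_le ht] at this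
  exact (continuousOn_const.add this).congr h.2

theorem mono (h : IsTrajectory f x t u d y) {a b : ℝ} (ha : t ≤ a) (hab : a ≤ b) (hb : b ≤ 0) :
    IntervalIntegrable (fun τ => f (y τ) (u τ) (d τ)) volume a b :=
  h.1.mono_set (by
    rw [uIcc_of_le hab, uIcc_of_le (ha.trans (hab.trans hb))]
    exact Icc_subset_Icc ha hb)

theorem restart (h : IsTrajectory f x t u d y) {r : ℝ} (hr : r ∈ Icc t 0) :
    IsTrajectory f (y r) r u d y := by
  refine ⟨h.mono hr.1 hr.2 le_rfl, fun s hs => ?_⟩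
  rw [h.2 s ⟨hr.1.trans hs.1, hs.2⟩, h.2 r hr, add_assoc,
    intervalIntegral.integral_add_adjacent_intervals (h.mono le_rfl hr.1 hr.2)
      (h.mono hr.1 hs.1 hs.2)]

theorem congr_ae (h : IsTrajectory f x t u d y) {u' : ℝ → E m} {d' : ℝ → E w} (ht : t ≤ 0)
    (hu : ∀ᵐ τ ∂(volume.restrict (Icc t 0)), u τ = u' τ)
    (hd : ∀ᵐ τ ∂(volume.restrict (Icc t 0)), d τ = d' τ) : IsTrajectory f x t u' d' y := by
  have key : ∀ᵐ τ ∂(volume.restrict (Icc t 0)), f (y τ) (u τ) (d τ) = f (y τ) (u' τ) (d' τ) := by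
    filter_upwards [hu, hd] with τ h1 h2
    rw [h1, h2]
  have hs : ∀ s ∈ Icc t 0, ∀ᵐ τ ∂(volume.restrict (uIoc t s)),
      f (y τ) (u τ) (d τ) = f (y τ) (u' τ) (d' τ) := fun s hs => by
    rw [uIoc_of_le hs.1]
    exact ae_restrict_of_ae_restrict_of_subset
      (Ioc_subset_Icc_self.trans (Icc_subset_Icc_right hs.2)) key
  refine ⟨h.1.congr_ae (hs 0 ⟨ht, le_rfl⟩), fun s hs' => ?_⟩
  rw [h.2 s hs', intervalIntegral.integral_congr_ae_restrict (hs s hs')]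

theorem norm_sub_le (hf : RegularDynamics f U D L M) {u : Signal U t} {d : Signal D t}
    (h : IsTrajectory f x t u.1 d.1 y) {s : ℝ} (hs : s ∈ Icc t 0) :
    ‖y s - x‖ ≤ M * (s - t) := by
  rw [h.2 s hs, add_sub_cancel_left]
  have := intervalIntegral.norm_integral_le_of_norm_le_const
    (f := fun τ => f (y τ) (u.1 τ) (d.1 τ)) (a := t) (b := s) (C := M) (fun τ hτ => by
      rw [uIoc_of_le hs.1] at hτ
      have hτ' : τ ∈ Icc t 0 := ⟨hτ.1.le, hτ.2.trans hs.2⟩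
      exact hf.norm_le _ _ (u.2.2 τ hτ') _ (d.2.2 τ hτ'))
  rwa [abs_of_nonneg (sub_nonneg.2 hs.1)] at this

/-- Trajectories whose inputs agree up to time `r` separate at most exponentially up to `r`. -/
theorem norm_sub_le_exp (hf : RegularDynamics f U D L M) {u v : Signal U t} {d e : Signal D t}
    {x' : E n} {y' : ℝ → E n} (h : IsTrajectory f x t u.1 d.1 y)
    (h' : IsTrajectory f x' t v.1 e.1 y') {r : ℝ} (hr : r ≤ 0)
    (hu : ∀ᵐ τ ∂(volume.restrict (Icc t r)), u.1 τ = v.1 τ)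
    (hd : ∀ᵐ τ ∂(volume.restrict (Icc t r)), d.1 τ = e.1 τ) :
    ∀ s ∈ Icc t r, ‖y s - y' s‖ ≤ ‖x - x'‖ * Real.exp (L * (s - t)) := by
  intro s₀ hs₀
  have ht : t ≤ 0 := (hs₀.1.trans hs₀.2).trans hr
  have hc : ContinuousOn (fun s => ‖y s - y' s‖) (Icc t r) :=
    (((h.continuousOn ht).sub (h'.continuousOn ht)).norm).mono (Icc_subset_Icc_right hr)
  refine le_mul_exp_of_le_add_integral hc L.2 (fun s hs => ?_) s₀ hs₀
  have hs0 : s ∈ Icc t 0 := ⟨hs.1, hs.2.trans hr⟩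
  rw [h.2 s hs0, h'.2 s hs0, add_sub_add_comm,
    ← intervalIntegral.integral_sub (h.mono le_rfl hs.1 hs0.2) (h'.mono le_rfl hs.1 hs0.2)]
  refine (norm_add_le _ _).trans (add_le_add le_rfl ?_)
  rw [← intervalIntegral.integral_const_mul]
  refine intervalIntegral.norm_integral_le_of_norm_le hs.1 ?_ ?_
  · have hsub : Ioc t s ⊆ Icc t r := Ioc_subset_Icc_self.trans (Icc_subset_Icc_right hs.2)
    rw [← ae_restrict_iff' measurableSet_Ioc]
    filter_upwards [ae_restrict_of_ae_restrict_of_subset hsub hu,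
      ae_restrict_of_ae_restrict_of_subset hsub hd, ae_restrict_mem measurableSet_Ioc]
      with τ h1 h2 h3
    have hτ : τ ∈ Icc t 0 := ⟨h3.1.le, h3.2.trans hs0.2⟩
    rw [h1, h2]
    exact hf.norm_sub_le (v.2.2 τ hτ) (e.2.2 τ hτ) _ _
  · refine ContinuousOn.intervalIntegrable ?_
    rw [uIcc_of_le hs.1]
    exact continuousOn_const.mul (hc.mono (Icc_subset_Icc_right hs.2))

/-- Gronwall with zero initial separation. Agreement of the inputs is needed only up to `r`: this
causality is what keeps concatenated strategies nonanticipative. -/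
theorem eqOn (hf : RegularDynamics f U D L M) {u v : Signal U t} {d e : Signal D t}
    {y' : ℝ → E n} (h : IsTrajectory f x t u.1 d.1 y)
    (h' : IsTrajectory f x t v.1 e.1 y') {r : ℝ} (hr : r ≤ 0)
    (hu : ∀ᵐ τ ∂(volume.restrict (Icc t r)), u.1 τ = v.1 τ)
    (hd : ∀ᵐ τ ∂(volume.restrict (Icc t r)), d.1 τ = e.1 τ) : EqOn y y' (Icc t r) := by
  intro s hs
  have := h.norm_sub_le_exp hf h' hr hu hd s hs
  simp only [sub_self, norm_zero, zero_mul] at this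
  exact sub_eq_zero.1 (norm_le_zero_iff.1 this)

end IsTrajectory

/-- Existence of trajectories, by a contraction argument for the exponentially rescaled path. -/
theorem RegularDynamics.exists_isTrajectory (hf : RegularDynamics f U D L M) (x : E n) (ht : t ≤ 0)
    (u : Signal U t) (d : Signal D t) : ∃ y, IsTrajectory f x t u.1 d.1 y := by
  -- The weight makes the contraction factor $L/K\le 1/2$ independently of the length of the
  -- interval; the summand 1 keeps `K` positive when `L = 0`.
  set K : ℝ := 2 * L + 1 with hK
  have hL : (0 : ℝ) ≤ L := L.2
  have hKpos : 0 < K := by positivity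
  -- The unknown is $z(s)=e^{-K(s-t)}y(s)$, and `ext` recovers $y$ from it. The sup norm of $z$ is a
  -- weighted norm of $y$.
  let ext : C(Icc t 0, E n) → ℝ → E n := fun z s => Real.exp (K * (s - t)) • IccExtend ht z s
  have hext : ∀ z, Continuous (ext z) := fun z => by
    have : Continuous (IccExtend ht z) := z.continuous.Icc_extend'
    fun_prop
  have hII : ∀ z : C(Icc t 0, E n), ∀ s ∈ Icc t 0,
      IntervalIntegrable (fun τ => f (ext z τ) (u.1 τ) (d.1 τ)) volume t s := fun z s hs =>
    hf.intervalIntegrable u d (hext z).continuousOn le_rfl hs.1 hs.2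
  let P : C(Icc t 0, E n) → C(Icc t 0, E n) := fun z =>
    ⟨fun s => Real.exp (-(K * (s - t))) • (x + ∫ τ in t..s, f (ext z τ) (u.1 τ) (d.1 τ)), by
      have h1 := intervalIntegral.continuousOn_primitive_interval' (hII z 0 ⟨ht, le_rfl⟩)
        left_mem_uIcc
      rw [uIcc_of_le ht] at h1
      have h2 := continuousOn_iff_continuous_domRestrict.1 h1
      have h3 : Continuous fun s : Icc t 0 => Real.exp (-(K * ((s : ℝ) - t))) := by fun_prop
      exact h3.smul (continuous_const.add h2)⟩
  have hP : ContractingWith (1 / 2) P := by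
    refine ⟨by norm_num [← NNReal.coe_lt_coe], LipschitzWith.of_dist_le_mul fun z z' => ?_⟩
    rw [ContinuousMap.dist_le (by positivity)]
    intro s
    have hs := s.2
    simp only [P, ContinuousMap.coe_mk, dist_eq_norm, ← smul_sub, add_sub_add_left_eq_sub]
    rw [← intervalIntegral.integral_sub (hII z s hs) (hII z' s hs), norm_smul, Real.norm_eq_abs,
      Real.abs_exp]
    have hbound : ‖∫ τ in t..s, (f (ext z τ) (u.1 τ) (d.1 τ) - f (ext z' τ) (u.1 τ) (d.1 τ))‖
        ≤ ∫ τ in t..s, L * ‖z - z'‖ * Real.exp (K * (τ - t)) := by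
      refine intervalIntegral.norm_integral_le_of_norm_le hs.1 ?_ ?_
      · refine Filter.Eventually.of_forall fun τ hτ => ?_
        have hτ' : τ ∈ Icc t 0 := ⟨hτ.1.le, hτ.2.trans hs.2⟩
        refine (hf.norm_sub_le (u.2.2 τ hτ') (d.2.2 τ hτ') _ _).trans ?_
        simp only [ext, ← smul_sub, norm_smul, Real.norm_eq_abs, Real.abs_exp]
        have : ‖IccExtend ht z τ - IccExtend ht z' τ‖ ≤ ‖z - z'‖ := by
          simpa [IccExtend] using (z - z').norm_coe_le_norm (projIcc t 0 ht τ)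
        have h2 := mul_le_mul_of_nonneg_left this (Real.exp_nonneg (K * (τ - t)))
        nlinarith
      · exact Continuous.intervalIntegrable (by fun_prop) _ _
    have hval : ∫ τ in t..(s : ℝ), L * ‖z - z'‖ * Real.exp (K * (τ - t))
        = L * ‖z - z'‖ * ((Real.exp (K * (s - t)) - 1) / K) := by
      rw [intervalIntegral.integral_const_mul]
      congr 1
      have : ∀ τ ∈ uIcc t (s : ℝ),
          HasDerivAt (fun τ => Real.exp (K * (τ - t)) / K) (Real.exp (K * (τ - t))) τ :=
        fun τ _ => by
          have h := ((((hasDerivAt_id τ).sub_const t).const_mul K).exp).div_const K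
          simpa [hKpos.ne'] using h
      rw [intervalIntegral.integral_eq_sub_of_hasDerivAt this
        (Continuous.intervalIntegrable (by fun_prop) _ _)]
      simp [sub_div]
    rw [hval] at hbound
    have he : Real.exp (-(K * (s - t))) * (Real.exp (K * (s - t)) - 1) ≤ 1 := by
      rw [mul_sub, ← Real.exp_add]
      simp [Real.exp_nonneg]
    have hLK : L / K ≤ 1 / 2 := by
      rw [div_le_iff₀ hKpos, hK]; linarith
    calc _ ≤ Real.exp (-(K * (s - t))) * (L * ‖z - z'‖ * ((Real.exp (K * (s - t)) - 1) / K)) :=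
          mul_le_mul_of_nonneg_left hbound (Real.exp_nonneg _)
      _ = (L / K) * ‖z - z'‖ *
          (Real.exp (-(K * (s - t))) * (Real.exp (K * (s - t)) - 1)) := by ring
      _ ≤ (L / K) * ‖z - z'‖ * 1 := mul_le_mul_of_nonneg_left he (by positivity)
      _ ≤ (1 / 2) * ‖z - z'‖ := by
          rw [mul_one]; exact mul_le_mul_of_nonneg_right hLK (norm_nonneg _)
      _ = _ := by simp
  have hz : P hP.fixedPoint = hP.fixedPoint := hP.fixedPoint_isFixedPt
  set z := hP.fixedPoint with hzdef
  refine ⟨ext z, hII z 0 ⟨ht, le_rfl⟩, fun s hs => ?_⟩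
  have h1 : z ⟨s, hs⟩ = Real.exp (-(K * (s - t))) •
      (x + ∫ τ in t..s, f (ext z τ) (u.1 τ) (d.1 τ)) := by
    conv_lhs => rw [← hz]
    rfl
  change Real.exp (K * (s - t)) • IccExtend ht z s = _
  rw [IccExtend_of_mem ht _ hs, h1, smul_smul, ← Real.exp_add]
  simp

theorem RegularDynamics.isTrajectory_trajectory (hf : RegularDynamics f U D L M) (x : E n)
    (ht : t ≤ 0) (u : Signal U t) (d : Signal D t) :
    IsTrajectory f x t u.1 d.1 (trajectory f x t u.1 d.1) :=
  Classical.epsilon_spec (hf.exists_isTrajectory x ht u d)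

end CBVF

/-! ### Signals, payoffs and the two halves of dynamic programming -/

namespace CBVF

variable {n m w : ℕ}

namespace Signal

variable {k : ℕ} {V : Set (E k)} {t : ℝ}

/-- The constant signal. -/
def const (t : ℝ) (v : E k) (hv : v ∈ V) : Signal V t :=
  ⟨fun _ => v, aemeasurable_const, fun _ _ => hv⟩

/-- The tail of a signal after time `r`. -/
def tail (u : Signal V t) {r : ℝ} (h : t ≤ r) : Signal V r :=
  ⟨u.1, u.2.1.mono_measure (Measure.restrict_mono (Icc_subset_Icc_left h) le_rfl),
    fun s hs => u.2.2 s ⟨h.trans hs.1, hs.2⟩⟩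

theorem tail_apply (u : Signal V t) {r : ℝ} (h : t ≤ r) : (u.tail h).1 = u.1 := by
  obtain ⟨u, hu⟩ := u
  change (tail ⟨u, hu⟩ h).1 = u
  rfl

open Classical in
/-- Follow `u` before time `r` and `v` afterwards. -/
noncomputable def append (u : Signal V t) {r : ℝ} (v : Signal V r) : Signal V t :=
  ⟨(Iio r).piecewise u.1 v.1, by
    have h₁ : AEMeasurable ((Iio r).piecewise u.1 v.1) (volume.restrict (Iio r ∩ Icc t 0)) :=
      (u.2.1.mono_measure (Measure.restrict_mono inter_subset_right le_rfl)).congr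
        ((ae_restrict_iff' (measurableSet_Iio.inter measurableSet_Icc)).2
          (Filter.Eventually.of_forall fun _ hτ => (piecewise_eq_of_mem _ _ _ hτ.1).symm))
    have h₂ : AEMeasurable ((Iio r).piecewise u.1 v.1) (volume.restrict (Icc r 0)) :=
      v.2.1.congr ((ae_restrict_iff' measurableSet_Icc).2 (Filter.Eventually.of_forall
        fun _ hτ => (piecewise_eq_of_notMem _ _ _ (notMem_Iio.2 hτ.1)).symm))
    refine (aemeasurable_union_iff.2 ⟨h₁, h₂⟩).mono_measure (Measure.restrict_mono ?_ le_rfl)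
    exact fun s hs => (lt_or_ge s r).imp (fun h => ⟨h, hs⟩) (fun h => ⟨h, hs.2⟩), by
    intro s hs
    rcases lt_or_ge s r with h | h
    · rw [piecewise_eq_of_mem _ _ _ (mem_Iio.2 h)]
      exact u.2.2 s hs
    · rw [piecewise_eq_of_notMem _ _ _ (notMem_Iio.2 h)]
      exact v.2.2 s ⟨h, hs.2⟩⟩

theorem append_apply_of_lt (u : Signal V t) {r : ℝ} (v : Signal V r) {τ : ℝ} (h : τ < r) :
    (u.append v).1 τ = u.1 τ := piecewise_eq_of_mem _ _ _ (mem_Iio.2 h)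

theorem append_apply_of_le (u : Signal V t) {r : ℝ} (v : Signal V r) {τ : ℝ} (h : r ≤ τ) :
    (u.append v).1 τ = v.1 τ :=
  piecewise_eq_of_notMem _ _ _ (notMem_Iio.2 h)

theorem append_ae_eq_left (u : Signal V t) {r : ℝ} (v : Signal V r) :
    ∀ᵐ τ ∂(volume.restrict (Icc t r)), (u.append v).1 τ = u.1 τ := by
  have h := (ae_restrict_iff' (μ := volume) (measurableSet_Ico (a := t) (b := r))).2
    (Filter.Eventually.of_forall fun τ hτ => append_apply_of_lt u v hτ.2)
  rwa [Measure.restrict_congr_set Ico_ae_eq_Icc] at h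

theorem append_ae_eq_right (u : Signal V t) {r : ℝ} (v : Signal V r) (s : ℝ) :
    ∀ᵐ τ ∂(volume.restrict (Icc r s)), (u.append v).1 τ = v.1 τ :=
  (ae_restrict_iff' measurableSet_Icc).2 (Filter.Eventually.of_forall fun _ hτ =>
    append_apply_of_le u v hτ.1)

/-- The response of a static measurable feedback law. -/
def feedback {U : Set (E m)} {D : Set (E w)} (u : Signal U t) (c : E m → E w) (hc : Measurable c)
    (hcU : ∀ v ∈ U, c v ∈ D) : Signal D t :=
  ⟨fun τ => c (u.1 τ), hc.comp_aemeasurable u.2.1, fun s hs => hcU _ (u.2.2 s hs)⟩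

end Signal

/-- The standing assumptions on the dynamics, the cost and the discount rate. -/
structure RegularProblem (f : E n → E m → E w → E n) (U : Set (E m)) (D : Set (E w))
    (l : E n → ℝ) (γ : ℝ) (L : NNReal) (M : ℝ) (K : NNReal) (C : ℝ) : Prop
    extends RegularDynamics f U D L M where
  lipschitz_cost : LipschitzWith K l
  abs_cost_le : ∀ x, |l x| ≤ C
  rate_nonneg : 0 ≤ γ

variable {f : E n → E m → E w → E n} {U : Set (E m)} {D : Set (E w)} {l : E n → ℝ} {γ : ℝ}
  {L : NNReal} {M : ℝ} {K : NNReal} {C : ℝ} {x : E n} {t : ℝ}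

theorem ae_restrict_Icc_union {P : ℝ → Prop} {a b c : ℝ}
    (h₁ : ∀ᵐ τ ∂(volume.restrict (Icc a b)), P τ) (h₂ : ∀ᵐ τ ∂(volume.restrict (Icc b c)), P τ) :
    ∀ᵐ τ ∂(volume.restrict (Icc a c)), P τ :=
  ae_restrict_of_ae_restrict_of_subset
    (fun s hs => (le_total s b).imp (fun h => ⟨hs.1, h⟩) (fun h => ⟨h, hs.2⟩))
    (ae_restrict_union_iff _ _ _ |>.2 ⟨h₁, h₂⟩)

theorem ae_restrict_Icc_mono {P : ℝ → Prop} {a b c d : ℝ}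
    (h : ∀ᵐ τ ∂(volume.restrict (Icc a b)), P τ) (hac : a ≤ c) (hdb : d ≤ b) :
    ∀ᵐ τ ∂(volume.restrict (Icc c d)), P τ :=
  ae_restrict_of_ae_restrict_of_subset (Icc_subset_Icc hac hdb) h

namespace RegularProblem

theorem bound_cost_nonneg (hp : RegularProblem f U D l γ L M K C) : 0 ≤ C :=
  (abs_nonneg _).trans (hp.abs_cost_le 0)

theorem exp_le (hp : RegularProblem f U D l γ L M K C) {s : ℝ} (hs : s ∈ Icc t 0) :
    Real.exp (γ * (s - t)) ≤ Real.exp (-(γ * t)) :=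
  Real.exp_le_exp.2 (by nlinarith [mul_nonpos_of_nonneg_of_nonpos hp.rate_nonneg hs.2])

theorem abs_running_le (hp : RegularProblem f U D l γ L M K C) {s : ℝ} (hs : s ∈ Icc t 0)
    (z : E n) : |Real.exp (γ * (s - t)) * l z| ≤ Real.exp (-(γ * t)) * C := by
  rw [abs_mul, Real.abs_exp]
  exact mul_le_mul (hp.exp_le hs) (hp.abs_cost_le z) (abs_nonneg _) (Real.exp_nonneg _)

/-- Boundedness of `l` enters here: a real infimum over a family unbounded below would take the
default value 0. -/
theorem payoff_le (hp : RegularProblem f U D l γ L M K C) (y : ℝ → E n) {s : ℝ}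
    (hs : s ∈ Icc t 0) : payoff γ l t y ≤ Real.exp (γ * (s - t)) * l (y s) := by
  refine ciInf_le (f := fun s : Icc t 0 => Real.exp (γ * ((s : ℝ) - t)) * l (y s))
    ⟨-(Real.exp (-(γ * t)) * C), ?_⟩ ⟨s, hs⟩
  rintro _ ⟨r, rfl⟩
  exact (abs_le.1 (hp.abs_running_le r.2 _)).1

end RegularProblem

theorem le_payoff (ht : t ≤ 0) {y : ℝ → E n} {a : ℝ}
    (h : ∀ s ∈ Icc t 0, a ≤ Real.exp (γ * (s - t)) * l (y s)) : a ≤ payoff γ l t y := by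
  have : Nonempty (Icc t 0) := ⟨⟨t, le_rfl, ht⟩⟩
  exact le_ciInf fun s => h s s.2

namespace RegularProblem

theorem abs_payoff_le (hp : RegularProblem f U D l γ L M K C) (ht : t ≤ 0) (y : ℝ → E n) :
    |payoff γ l t y| ≤ Real.exp (-(γ * t)) * C :=
  abs_le.2 ⟨le_payoff ht fun _ hs => (abs_le.1 (hp.abs_running_le hs _)).1,
    (hp.payoff_le y ⟨le_rfl, ht⟩).trans (abs_le.1 (hp.abs_running_le ⟨le_rfl, ht⟩ _)).2⟩

theorem payoff_le_add (hp : RegularProblem f U D l γ L M K C) (ht : t ≤ 0) {y y' : ℝ → E n}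
    {r : ℝ} (h : ∀ s ∈ Icc t 0, ‖y s - y' s‖ ≤ r) :
    payoff γ l t y ≤ payoff γ l t y' + Real.exp (-(γ * t)) * (K * r) := by
  rw [← sub_le_iff_le_add]
  refine le_payoff ht fun s hs => ?_
  have h1 := hp.payoff_le y hs
  have h2 : l (y s) - l (y' s) ≤ K * r := by
    have := hp.lipschitz_cost.dist_le_mul (y s) (y' s)
    rw [Real.dist_eq, dist_eq_norm] at this
    exact (le_abs_self _).trans (this.trans (mul_le_mul_of_nonneg_left (h s hs) K.2))
  have hr : 0 ≤ K * r := mul_nonneg K.2 ((norm_nonneg _).trans (h s hs))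
  have h3 : Real.exp (γ * (s - t)) * (l (y s) - l (y' s)) ≤ Real.exp (-(γ * t)) * (K * r) :=
    (mul_le_mul_of_nonneg_left h2 (Real.exp_nonneg _)).trans
      (mul_le_mul_of_nonneg_right (hp.exp_le hs) hr)
  linarith

theorem payoff_congr {y y' : ℝ → E n} (h : EqOn y y' (Icc t 0)) :
    payoff γ l t y = payoff γ l t y' := by
  unfold payoff
  congr 1
  funext s
  rw [h s.2]

/-- Discarding the times before `r` can only raise the minimum, and
$e^{\gamma(s-t)}=e^{\gamma(s-r)}e^{\gamma(r-t)}$. With `le_payoff_of_split` this is dynamic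
programming for a single path. -/
theorem payoff_le_exp_mul_payoff (hp : RegularProblem f U D l γ L M K C) (y : ℝ → E n) {r : ℝ}
    (hr : r ∈ Icc t 0) : payoff γ l t y ≤ Real.exp (γ * (r - t)) * payoff γ l r y := by
  rw [mul_comm, ← div_le_iff₀ (Real.exp_pos _)]
  refine le_payoff hr.2 fun s hs => ?_
  rw [div_le_iff₀ (Real.exp_pos _), mul_right_comm, ← Real.exp_add]
  have h := hp.payoff_le y (t := t) ⟨hr.1.trans hs.1, hs.2⟩
  rwa [show γ * (s - t) = γ * (s - r) + γ * (r - t) by ring] at h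

theorem le_payoff_of_split (hp : RegularProblem f U D l γ L M K C) {y : ℝ → E n} {r a : ℝ}
    (hr : r ∈ Icc t 0) (h₁ : ∀ s ∈ Icc t r, a ≤ Real.exp (γ * (s - t)) * l (y s))
    (h₂ : a ≤ Real.exp (γ * (r - t)) * payoff γ l r y) : a ≤ payoff γ l t y := by
  refine le_payoff (hr.1.trans hr.2) fun s hs => ?_
  rcases le_total s r with hsr | hsr
  · exact h₁ s ⟨hs.1, hsr⟩
  · refine h₂.trans ?_
    refine (mul_le_mul_of_nonneg_left (hp.payoff_le y ⟨hsr, hs.2⟩) (Real.exp_nonneg _)).trans ?_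
    rw [← mul_assoc, ← Real.exp_add]
    apply le_of_eq
    congr 2
    ring

theorem nonempty_signal_left (hp : RegularProblem f U D l γ L M K C) (t : ℝ) :
    Nonempty (Signal U t) :=
  hp.nonempty_left.elim fun u hu => ⟨Signal.const t u hu⟩

theorem nonempty_strategy (hp : RegularProblem f U D l γ L M K C) (t : ℝ) :
    Nonempty (Strategy U D t) :=
  hp.nonempty_right.elim fun d hd => ⟨⟨fun _ => Signal.const t d hd, fun _ _ _ _ _ =>
    Filter.Eventually.of_forall fun _ => rfl⟩⟩

theorem bddAbove_payoff (hp : RegularProblem f U D l γ L M K C) (ht : t ≤ 0) (x : E n)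
    (ξ : Strategy U D t) : BddAbove (range fun u : Signal U t =>
      payoff γ l t (trajectory f x t u.1 (ξ.1 u).1)) := by
  refine ⟨Real.exp (-(γ * t)) * C, ?_⟩
  rintro _ ⟨u, rfl⟩
  exact (abs_le.1 (hp.abs_payoff_le ht _)).2

/-- With `exists_strategy`, `le_value` and `exists_control` this handles the inf sup through nearly
optimal choices; later arguments use only these four facts. -/
theorem value_le (hp : RegularProblem f U D l γ L M K C) (ht : t ≤ 0) (ξ : Strategy U D t) {a : ℝ}
    (h : ∀ u : Signal U t, payoff γ l t (trajectory f x t u.1 (ξ.1 u).1) ≤ a) :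
    value f U D l γ x t ≤ a := by
  have := hp.nonempty_signal_left t
  refine (ciInf_le ⟨-(Real.exp (-(γ * t)) * C), ?_⟩ ξ).trans (ciSup_le h)
  rintro _ ⟨ξ', rfl⟩
  obtain ⟨u⟩ := hp.nonempty_signal_left t
  exact (abs_le.1 (hp.abs_payoff_le ht _)).1.trans (le_ciSup (hp.bddAbove_payoff ht x ξ') u)

theorem exists_strategy (hp : RegularProblem f U D l γ L M K C) (ht : t ≤ 0) (x : E n) {ε : ℝ}
    (hε : 0 < ε) : ∃ ξ : Strategy U D t, ∀ u : Signal U t,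
      payoff γ l t (trajectory f x t u.1 (ξ.1 u).1) ≤ value f U D l γ x t + ε := by
  have := hp.nonempty_strategy t
  obtain ⟨ξ, hξ⟩ := exists_lt_of_ciInf_lt (lt_add_of_pos_right (value f U D l γ x t) hε)
  exact ⟨ξ, fun u => (le_ciSup (hp.bddAbove_payoff ht x ξ) u).trans hξ.le⟩

theorem le_value (hp : RegularProblem f U D l γ L M K C) (ht : t ≤ 0) {a : ℝ}
    (h : ∀ ξ : Strategy U D t, ∃ u : Signal U t,
      a ≤ payoff γ l t (trajectory f x t u.1 (ξ.1 u).1)) : a ≤ value f U D l γ x t := by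
  have := hp.nonempty_strategy t
  refine le_ciInf fun ξ => ?_
  obtain ⟨u, hu⟩ := h ξ
  exact hu.trans (le_ciSup (hp.bddAbove_payoff ht x ξ) u)

theorem exists_control (hp : RegularProblem f U D l γ L M K C) (ht : t ≤ 0) (x : E n)
    (ξ : Strategy U D t) {ε : ℝ} (hε : 0 < ε) : ∃ u : Signal U t,
      value f U D l γ x t - ε ≤ payoff γ l t (trajectory f x t u.1 (ξ.1 u).1) := by
  have := hp.nonempty_signal_left t
  by_contra! h
  have := hp.value_le ht ξ (x := x) (fun u => (h u).le)
  linarith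

theorem abs_value_le (hp : RegularProblem f U D l γ L M K C) (ht : t ≤ 0) (x : E n) :
    |value f U D l γ x t| ≤ Real.exp (-(γ * t)) * C := by
  obtain ⟨ξ⟩ := hp.nonempty_strategy t
  obtain ⟨u⟩ := hp.nonempty_signal_left t
  exact abs_le.2 ⟨hp.le_value ht fun ξ => ⟨u, (abs_le.1 (hp.abs_payoff_le ht _)).1⟩,
    hp.value_le ht ξ fun u => (abs_le.1 (hp.abs_payoff_le ht _)).2⟩

theorem value_le_cost (hp : RegularProblem f U D l γ L M K C) (ht : t ≤ 0) (x : E n) :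
    value f U D l γ x t ≤ l x := by
  obtain ⟨ξ⟩ := hp.nonempty_strategy t
  refine hp.value_le ht ξ fun u => ?_
  have := hp.payoff_le (trajectory f x t u.1 (ξ.1 u).1) (t := t) ⟨le_rfl, ht⟩
  rwa [(hp.isTrajectory_trajectory x ht u (ξ.1 u)).apply_initial ht, sub_self, mul_zero,
    Real.exp_zero, one_mul] at this

theorem value_zero (hp : RegularProblem f U D l γ L M K C) (x : E n) :
    value f U D l γ x 0 = l x := by
  refine le_antisymm (hp.value_le_cost le_rfl x) (hp.le_value le_rfl fun ξ => ?_)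
  obtain ⟨u⟩ := hp.nonempty_signal_left 0
  refine ⟨u, le_payoff le_rfl fun s hs => ?_⟩
  obtain rfl : s = 0 := le_antisymm hs.2 hs.1
  rw [(hp.isTrajectory_trajectory x le_rfl u (ξ.1 u)).apply_initial le_rfl]
  simp

/-- Dynamic programming, upper half: the disturbance may use a static feedback law up to time `r`
and a nearly optimal strategy afterwards. -/
theorem value_le_of_feedback (hp : RegularProblem f U D l γ L M K C) {r a : ℝ} (hr : r ∈ Icc t 0)
    (c : E m → E w) (hc : Measurable c) (hcU : ∀ v ∈ U, c v ∈ D)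
    (h : ∀ (u : Signal U t) (y : ℝ → E n), IsTrajectory f x t u.1 (u.feedback c hc hcU).1 y →
      Real.exp (γ * (r - t)) * value f U D l γ (y r) r ≤ a) :
    value f U D l γ x t ≤ a := by
  have ht := hr.1.trans hr.2
  refine le_of_forall_pos_le_add fun ε hε => ?_
  -- The tail payoff is later multiplied by $e^{\gamma(r-t)}$, which turns this error into `ε`.
  have hε' : 0 < ε / Real.exp (γ * (r - t)) := div_pos hε (Real.exp_pos _)
  -- One strategy per possible state at time `r`. No measurability in `z` is needed, since each
  -- control reaches a single state.
  choose ξ hξ using fun z : E n => hp.exists_strategy hr.2 z hε'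
  choose y hy using fun u : Signal U t =>
    hp.exists_isTrajectory x ht u (u.feedback c hc hcU)
  obtain ⟨η, hηdef⟩ : ∃ η : Signal U t → Signal D t, ∀ u, η u =
    (u.feedback c hc hcU).append ((ξ (y u r)).1 (u.tail hr.1)) := ⟨_, fun _ => rfl⟩
  have hη : Nonanticipative η := by
    intro u v s hs huv
    rw [hηdef, hηdef]
    have hfb : ∀ᵐ τ ∂(volume.restrict (Icc t s)),
        (u.feedback c hc hcU).1 τ = (v.feedback c hc hcU).1 τ := by
      filter_upwards [huv] with τ hτ
      simp only [Signal.feedback, hτ]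
    rcases lt_or_ge s r with hsr | hrs
    · filter_upwards [hfb, ae_restrict_mem measurableSet_Icc] with τ h1 h2
      rw [Signal.append_apply_of_lt _ _ (h2.2.trans_lt hsr),
        Signal.append_apply_of_lt _ _ (h2.2.trans_lt hsr), h1]
    -- Controls that agree beyond `r` have reached the same state at `r`, so the same continuation
    -- strategy was selected for both.
    · have hyr : y u r = y v r := (hy u).eqOn hp.toRegularDynamics (hy v) hr.2
        (ae_restrict_Icc_mono huv le_rfl hrs) (ae_restrict_Icc_mono hfb le_rfl hrs) ⟨hr.1, le_rfl⟩
      refine ae_restrict_Icc_union (b := r) ?_ ?_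
      · filter_upwards [ae_restrict_Icc_mono hfb le_rfl hrs, Signal.append_ae_eq_left
          (u.feedback c hc hcU) ((ξ (y u r)).1 (u.tail hr.1)), Signal.append_ae_eq_left
          (v.feedback c hc hcU) ((ξ (y v r)).1 (v.tail hr.1))] with τ h1 h2 h3
        rw [h2, h3, h1]
      · have h0 := (ξ (y u r)).2 (u.tail hr.1) (v.tail hr.1) s ⟨hrs, hs.2⟩
          (ae_restrict_Icc_mono huv hr.1 le_rfl)
        filter_upwards [h0, ae_restrict_mem measurableSet_Icc] with τ h1 h2
        rw [Signal.append_apply_of_le _ _ h2.1, Signal.append_apply_of_le _ _ h2.1, h1, hyr]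
  refine hp.value_le ht ⟨η, hη⟩ fun u => ?_
  have hη₁ : ∀ᵐ τ ∂(volume.restrict (Icc t r)), (η u).1 τ = (u.feedback c hc hcU).1 τ := by
    rw [hηdef]
    exact Signal.append_ae_eq_left _ _
  have hη₂ : ∀ᵐ τ ∂(volume.restrict (Icc r 0)),
      ((η u).tail hr.1).1 τ = ((ξ (y u r)).1 (u.tail hr.1)).1 τ := by
    rw [hηdef]
    exact Signal.append_ae_eq_right _ _ _
  have hY := hp.isTrajectory_trajectory x ht u (η u)
  change payoff γ l t (trajectory f x t u.1 (η u).1) ≤ a + ε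
  generalize trajectory f x t u.1 (η u).1 = Y at hY ⊢
  have hYy : Y r = y u r := hY.eqOn hp.toRegularDynamics (hy u) hr.2
    (Filter.Eventually.of_forall fun _ => rfl) hη₁ ⟨hr.1, le_rfl⟩
  have hZ := hp.isTrajectory_trajectory (y u r) hr.2 (u.tail hr.1) ((ξ (y u r)).1 (u.tail hr.1))
  have hY' : IsTrajectory f (y u r) r (u.tail hr.1).1 ((η u).tail hr.1).1 Y := by
    rw [← hYy, Signal.tail_apply, Signal.tail_apply]
    exact hY.restart hr
  have heq := hY'.eqOn hp.toRegularDynamics hZ le_rfl (Filter.Eventually.of_forall fun _ => rfl)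
    hη₂
  calc payoff γ l t Y ≤ Real.exp (γ * (r - t)) * payoff γ l r Y :=
        hp.payoff_le_exp_mul_payoff Y hr
    _ ≤ Real.exp (γ * (r - t)) *
        (value f U D l γ (y u r) r + ε / Real.exp (γ * (r - t))) := by
        rw [payoff_congr heq]
        exact mul_le_mul_of_nonneg_left (hξ _ _) (Real.exp_nonneg _)
    _ = Real.exp (γ * (r - t)) * value f U D l γ (y u r) r + ε := by
        rw [mul_add, mul_div_cancel₀ _ (Real.exp_pos _).ne']
    _ ≤ a + ε := by gcongr; exact h u _ (hy u)

/-- Dynamic programming, lower half: the control may be constant up to time `r` and respond nearly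
optimally to the disturbance strategy afterwards. -/
theorem le_value_of_const (hp : RegularProblem f U D l γ L M K C) {r a : ℝ} (hr : r ∈ Icc t 0)
    {v : E m} (hv : v ∈ U)
    (h₁ : ∀ (d : Signal D t) (y : ℝ → E n), IsTrajectory f x t (Signal.const t v hv).1 d.1 y →
      ∀ s ∈ Icc t r, a ≤ Real.exp (γ * (s - t)) * l (y s))
    (h₂ : ∀ (d : Signal D t) (y : ℝ → E n), IsTrajectory f x t (Signal.const t v hv).1 d.1 y →
      a ≤ Real.exp (γ * (r - t)) * value f U D l γ (y r) r) :
    a ≤ value f U D l γ x t := by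
  have ht := hr.1.trans hr.2
  refine le_of_forall_pos_le_add fun ε hε => ?_
  rw [← sub_le_iff_le_add]
  refine hp.le_value ht fun ξ => ?_
  have hε' : 0 < ε / Real.exp (γ * (r - t)) := div_pos hε (Real.exp_pos _)
  generalize Signal.const t v hv = v₀ at h₁ h₂
  obtain ⟨y, hy⟩ := hp.exists_isTrajectory x ht v₀ (ξ.1 v₀)
  -- Freezing the past control `v₀` turns `ξ` into a strategy on `[r, 0]`, against which a nearly
  -- optimal control exists.
  obtain ⟨η, hηdef⟩ : ∃ η : Signal U r → Signal D r, ∀ u, η u =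
    (ξ.1 (v₀.append u)).tail hr.1 := ⟨_, fun _ => rfl⟩
  have hη : Nonanticipative η := by
    intro u u' s hs huu
    rw [hηdef, hηdef]
    refine ae_restrict_Icc_mono (ξ.2 (v₀.append u) (v₀.append u') s ⟨hr.1.trans hs.1, hs.2⟩ ?_)
      hr.1 le_rfl
    refine ae_restrict_Icc_union (b := r) ?_ ?_
    · filter_upwards [v₀.append_ae_eq_left u, v₀.append_ae_eq_left u'] with τ h1 h2
      rw [h1, h2]
    · filter_upwards [v₀.append_ae_eq_right u s, v₀.append_ae_eq_right u' s, huu] with τ h1 h2 h3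
      rw [h1, h2, h3]
  obtain ⟨u, hu⟩ := hp.exists_control hr.2 (y r) ⟨η, hη⟩ hε'
  refine ⟨v₀.append u, ?_⟩
  have hY := hp.isTrajectory_trajectory x ht (v₀.append u) (ξ.1 (v₀.append u))
  generalize trajectory f x t (v₀.append u).1 (ξ.1 (v₀.append u)).1 = Y at hY ⊢
  -- By nonanticipativity the response up to `r` does not see the continuation `u`, so `u` could be
  -- chosen after the state `y r` was known.
  have hYy : EqOn Y y (Icc t r) := hY.eqOn hp.toRegularDynamics hy hr.2 (v₀.append_ae_eq_left u)
    (ξ.2 _ _ r hr (v₀.append_ae_eq_left u))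
  have hYr : Y r = y r := hYy ⟨hr.1, le_rfl⟩
  have hY' : IsTrajectory f (y r) r ((v₀.append u).tail hr.1).1 (η u).1 Y := by
    rw [← hYr, hηdef, Signal.tail_apply, Signal.tail_apply]
    exact hY.restart hr
  have heq := hY'.eqOn hp.toRegularDynamics (hp.isTrajectory_trajectory (y r) hr.2 u (η u)) le_rfl
    (v₀.append_ae_eq_right u 0) (Filter.Eventually.of_forall fun _ => rfl)
  refine hp.le_payoff_of_split hr (fun s hs => ?_) ?_
  · rw [hYy hs]
    linarith [h₁ _ y hy s hs]
  · rw [payoff_congr heq]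
    refine le_trans ?_ (mul_le_mul_of_nonneg_left hu (Real.exp_nonneg _))
    rw [mul_sub, mul_div_cancel₀ _ (Real.exp_pos _).ne']
    linarith [h₂ _ y hy]

/-- A nearly optimal strategy for `x'` is used from `x`; for each control the two trajectories have
the same inputs and separate by at most $e^{-Lt}\|x-x'\|$. -/
theorem value_le_value_add (hp : RegularProblem f U D l γ L M K C) (ht : t ≤ 0) (x x' : E n) :
    value f U D l γ x t ≤ value f U D l γ x' t +
      Real.exp (-(γ * t)) * (K * (‖x - x'‖ * Real.exp (-(L * t)))) := by
  refine le_of_forall_pos_le_add fun ε hε => ?_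
  obtain ⟨ξ, hξ⟩ := hp.exists_strategy ht x' hε
  refine hp.value_le ht ξ fun u => ?_
  have h1 := hp.isTrajectory_trajectory x ht u (ξ.1 u)
  have h2 := hp.isTrajectory_trajectory x' ht u (ξ.1 u)
  have h3 := hp.payoff_le_add ht (r := ‖x - x'‖ * Real.exp (-(L * t))) (fun s hs =>
    (h1.norm_sub_le_exp hp.toRegularDynamics h2 le_rfl (Filter.Eventually.of_forall fun _ => rfl)
      (Filter.Eventually.of_forall fun _ => rfl) s hs).trans
      (mul_le_mul_of_nonneg_left (Real.exp_le_exp.2 (by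
        have hL : (0 : ℝ) ≤ L := L.2
        nlinarith [mul_nonpos_of_nonneg_of_nonpos hL hs.2])) (norm_nonneg _)))
  linarith [hξ u]

end RegularProblem

/-! ### Lipschitz continuity of the value -/

theorem abs_exp_mul_sub_le {r R v A : ℝ} (hr : 0 ≤ r) (hrR : r ≤ R) (hv : |v| ≤ A) :
    |Real.exp r * v - v| ≤ r * Real.exp R * A := by
  have h1 : Real.exp r * v - v = (Real.exp r - 1) * v := by ring
  have h0 : 0 ≤ Real.exp r - 1 := by linarith [Real.one_le_exp hr]
  have h2 : Real.exp r - 1 ≤ r * Real.exp R := by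
    -- This is $1-r\le e^{-r}$ multiplied by $e^r$.
    have h3 : Real.exp r - 1 ≤ r * Real.exp r := by
      have h4 := Real.add_one_le_exp (-r)
      have h5 : Real.exp r * Real.exp (-r) = 1 := by rw [← Real.exp_add]; simp
      nlinarith [Real.exp_pos r]
    exact h3.trans (mul_le_mul_of_nonneg_left (Real.exp_le_exp.2 hrR) hr)
  rw [h1, abs_mul, abs_of_nonneg h0]
  exact mul_le_mul h2 hv (abs_nonneg _) (h0.trans h2)

namespace RegularProblem

theorem exists_lipschitzOnWith_value (hp : RegularProblem f U D l γ L M K C) (T : ℝ) :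
    ∃ Λ : NNReal, LipschitzOnWith Λ (fun p : E n × ℝ => value f U D l γ p.1 p.2)
      (univ ×ˢ Icc T 0) := by
  set A : ℝ := Real.exp (-(γ * T)) * C with hA
  set B : ℝ := Real.exp (-(γ * T)) * (K * Real.exp (-(L * T))) with hB
  have hC := hp.bound_cost_nonneg
  have hM := hp.bound_nonneg
  have hγ := hp.rate_nonneg
  have hK : (0 : ℝ) ≤ K := K.2
  have hA0 : 0 ≤ A := by positivity
  have hB0 : 0 ≤ B := by positivity
  have hexp : ∀ {t}, T ≤ t → Real.exp (-(γ * t)) ≤ Real.exp (-(γ * T)) := fun h =>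
    Real.exp_le_exp.2 (by nlinarith)
  have hx : ∀ {t}, t ∈ Icc T 0 → ∀ x x', value f U D l γ x t ≤ value f U D l γ x' t
      + B * ‖x - x'‖ := fun {t} ht x x' => by
    refine (hp.value_le_value_add ht.2 x x').trans (add_le_add_right ?_ _)
    have h2 : Real.exp (-(L * t)) ≤ Real.exp (-(L * T)) :=
      Real.exp_le_exp.2 (neg_le_neg (mul_le_mul_of_nonneg_left ht.1 L.2))
    calc _ = Real.exp (-(γ * t)) * Real.exp (-(L * t)) * (K * ‖x - x'‖) := by ring
      _ ≤ Real.exp (-(γ * T)) * Real.exp (-(L * T)) * (K * ‖x - x'‖) := by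
        gcongr
        exact ht.1
      _ = _ := by rw [hB]; ring
  have hval : ∀ {t}, t ∈ Icc T 0 → ∀ x, |value f U D l γ x t| ≤ A := fun ht x =>
    (hp.abs_value_le ht.2 x).trans (mul_le_mul_of_nonneg_right (hexp ht.1) hC)
  -- The sign of `T` is not prescribed; for `T > 0` the time interval is empty.
  have hCA : C ≤ A ∨ T > 0 := by
    rcases le_or_gt T 0 with h | h
    · left
      have : 1 ≤ Real.exp (-(γ * T)) := Real.one_le_exp (by nlinarith)
      nlinarith
    · exact Or.inr h
  -- The first term is the change of the discount factor over `[t, r]`. In the second, the path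
  -- moves at most $M(r-t)$, which changes the value by the factor `B` and the obstacle by the
  -- factor `K`.
  set Q : ℝ := γ * Real.exp (-(γ * T)) * A + (B + K) * M with hQ
  have hQ0 : 0 ≤ Q := by positivity
  have htime : ∀ {t r}, T ≤ t → t ≤ r → r ≤ 0 → ∀ x,
      |value f U D l γ x t - value f U D l γ x r| ≤ Q * (r - t) := fun {t r} hT htr hr x => by
    have hr' : r ∈ Icc t 0 := ⟨htr, hr⟩
    have hrT : r ∈ Icc T 0 := ⟨hT.trans htr, hr⟩
    have hCA' : C ≤ A := hCA.resolve_right (by linarith)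
    have hδ : 0 ≤ r - t := sub_nonneg.2 htr
    have hexp1 : ∀ {s v}, s ∈ Icc t r → |v| ≤ A →
        |Real.exp (γ * (s - t)) * v - v| ≤ γ * Real.exp (-(γ * T)) * A * (r - t) :=
      fun {s v} hs hv => by
        have h1 : 0 ≤ γ * (s - t) := mul_nonneg hγ (sub_nonneg.2 hs.1)
        refine (abs_exp_mul_sub_le h1 (R := -(γ * T)) (by nlinarith [hs.2]) hv).trans ?_
        have : γ * (s - t) ≤ γ * (r - t) := mul_le_mul_of_nonneg_left (by linarith [hs.2]) hγ
        calc _ ≤ γ * (r - t) * Real.exp (-(γ * T)) * A := by gcongr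
          _ = _ := by ring
    have hspeed : ∀ {u : Signal U t} {d : Signal D t} {y : ℝ → E n},
        IsTrajectory f x t u.1 d.1 y → ∀ s ∈ Icc t r, ‖y s - x‖ ≤ M * (r - t) :=
      fun hy s hs => (hy.norm_sub_le hp.toRegularDynamics ⟨hs.1, hs.2.trans hr⟩).trans
        (mul_le_mul_of_nonneg_left (by linarith [hs.2]) hM)
    rw [abs_le]
    constructor
    · obtain ⟨v, hv⟩ := hp.nonempty_left
      have : value f U D l γ x r - Q * (r - t) ≤ value f U D l γ x t := by
        refine hp.le_value_of_const hr' hv (fun d y hy s hs => ?_) (fun d y hy => ?_)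
        · have h1 := (abs_le.1 (hexp1 hs ((hp.abs_cost_le (y s)).trans hCA'))).1
          have h2 := hp.value_le_cost hr x
          have h3 := hp.lipschitz_cost.dist_le_mul x (y s)
          rw [Real.dist_eq, dist_comm, dist_eq_norm] at h3
          have h4 := (le_abs_self _).trans
            (h3.trans (mul_le_mul_of_nonneg_left (hspeed hy s hs) hK))
          have h5 : 0 ≤ B * M * (r - t) := by positivity
          rw [hQ]
          nlinarith
        · have h1 := (abs_le.1 (hexp1 ⟨htr, le_rfl⟩ (hval hrT (y r)))).1
          have h2 := hx hrT x (y r)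
          have h3 := mul_le_mul_of_nonneg_left (hspeed hy r ⟨htr, le_rfl⟩) hB0
          rw [norm_sub_rev] at h3
          have h5 : 0 ≤ K * M * (r - t) := by positivity
          rw [hQ]
          nlinarith
      linarith
    · obtain ⟨d, hd⟩ := hp.nonempty_right
      have : value f U D l γ x t ≤ value f U D l γ x r + Q * (r - t) := by
        refine hp.value_le_of_feedback hr' (fun _ => d) measurable_const (fun _ _ => hd)
          (fun u y hy => ?_)
        have h1 := (abs_le.1 (hexp1 ⟨htr, le_rfl⟩ (hval hrT (y r)))).2
        have h2 := hx hrT (y r) x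
        have h3 := mul_le_mul_of_nonneg_left (hspeed hy r ⟨htr, le_rfl⟩) hB0
        have h5 : 0 ≤ K * M * (r - t) := by positivity
        rw [hQ]
        nlinarith
      linarith
  refine ⟨⟨B + Q, by positivity⟩, LipschitzOnWith.of_dist_le_mul ?_⟩
  have hmain : ∀ {p q : E n × ℝ}, p.2 ∈ Icc T 0 → q.2 ∈ Icc T 0 → p.2 ≤ q.2 →
      dist (value f U D l γ p.1 p.2) (value f U D l γ q.1 q.2) ≤ (B + Q) * dist p q := by
    rintro ⟨x, t⟩ ⟨x', r⟩ ht hr htr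
    have h1 := htime ht.1 htr hr.2 x
    have h2 : |value f U D l γ x r - value f U D l γ x' r| ≤ B * ‖x - x'‖ := by
      have ha := hx hr x x'
      have hb := hx hr x' x
      rw [norm_sub_rev] at hb
      exact abs_le.2 ⟨by linarith, by linarith⟩
    have h3 : ‖x - x'‖ ≤ dist (x, t) (x', r) := by
      rw [← dist_eq_norm]; exact le_max_left _ _
    have h4 : r - t ≤ dist (x, t) (x', r) := by
      refine le_trans ?_ (le_max_right _ _)
      rw [dist_comm, Real.dist_eq]; exact le_abs_self _
    rw [Real.dist_eq]
    have h5 := abs_sub_le (value f U D l γ x t) (value f U D l γ x r) (value f U D l γ x' r)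
    have h6 := mul_le_mul_of_nonneg_left h3 hB0
    have h7 := mul_le_mul_of_nonneg_left h4 hQ0
    linarith
  intro p hp' q hq
  rcases le_total p.2 q.2 with h | h
  · exact hmain hp'.2 hq.2 h
  · rw [dist_comm, dist_comm p q]
    exact hmain hq.2 hp'.2 h

theorem continuousOn_value (hp : RegularProblem f U D l γ L M K C) :
    ContinuousOn (fun p : E n × ℝ => value f U D l γ p.1 p.2) (univ ×ˢ Iic 0) := by
  rintro ⟨x, t⟩ ⟨-, ht⟩
  obtain ⟨Λ, hΛ⟩ := hp.exists_lipschitzOnWith_value (t - 1)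
  refine (hΛ.continuousOn (x, t) ⟨mem_univ _, by simp, ht⟩).mono_of_mem_nhdsWithin ?_
  have : univ ×ˢ Ioi (t - 1) ∈ nhds (x, t) :=
    (isOpen_univ.prod isOpen_Ioi).mem_nhds ⟨mem_univ _, by simp⟩
  filter_upwards [nhdsWithin_le_nhds this, self_mem_nhdsWithin] with p h1 h2
  exact ⟨mem_univ _, h1.2.le, h2.2⟩

end RegularProblem

end CBVF

/-! ### The value is a viscosity solution -/

namespace CBVF

variable {n m w : ℕ}
variable {f : E n → E m → E w → E n} {U : Set (E m)} {D : Set (E w)} {l : E n → ℝ} {γ : ℝ}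
  {L : NNReal} {M : ℝ} {K : NNReal} {C : ℝ} {x : E n} {t : ℝ}

/-- A measurable selection of approximate minimizers. -/
theorem exists_measurable_selection (hU : MeasurableSet U) (hD : D.Nonempty)
    {F : E m × E w → ℝ} (hF : ContinuousOn F (U ×ˢ D)) {b : ℝ}
    (h : ∀ u ∈ U, ∃ d ∈ D, F (u, d) < b) :
    ∃ c : E m → E w, Measurable c ∧ (∀ u ∈ U, c u ∈ D) ∧ ∀ u ∈ U, F (u, c u) < b := by
  classical
  have : Nonempty D := hD.to_subtype
  let d : ℕ → D := TopologicalSpace.denseSeq D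
  -- The selection takes the first member of a dense sequence of `D` that meets the strict bound.
  -- The premise `u ∈ U` makes the index exist for every `u`.
  have hp : ∀ u, ∃ k, u ∈ U → F (u, d k) < b := by
    intro u
    by_cases hu : u ∈ U
    · obtain ⟨d₀, hd₀, hlt⟩ := h u hu
      have hc : Continuous fun e : D => F (u, e) :=
        hF.comp_continuous (by fun_prop) fun e => ⟨hu, e.2⟩
      obtain ⟨k, hk⟩ := (TopologicalSpace.denseRange_denseSeq D).exists_mem_open
        (isOpen_Iio.preimage hc : IsOpen ((fun e : D => F (u, e)) ⁻¹' Iio b)) ⟨⟨d₀, hd₀⟩, hlt⟩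
      exact ⟨k, fun _ => hk⟩
    · exact ⟨0, fun h => absurd h hu⟩
  have hmeas : ∀ k, MeasurableSet {u | u ∈ U → F (u, d k) < b} := by
    intro k
    have hc : ContinuousOn (fun u => F (u, d k)) U :=
      hF.comp (by fun_prop) fun u hu => ⟨hu, (d k).2⟩
    obtain ⟨O, hO, hOU⟩ := continuousOn_iff'.1 hc (Iio b) isOpen_Iio
    have : {u | u ∈ U → F (u, d k) < b} = Uᶜ ∪ (O ∩ U) := by
      rw [← hOU]
      ext u
      simp only [mem_ofPred_eq, mem_union, mem_compl_iff, mem_inter_iff, mem_preimage, mem_Iio]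
      tauto
    rw [this]
    exact hU.compl.union (hO.measurableSet.inter hU)
  refine ⟨fun u => d (Nat.find (hp u)), ?_, fun u _ => (d _).2, fun u hu => Nat.find_spec (hp u) hu⟩
  exact Measurable.find (f := fun k _ => (d k : E w)) (fun k => measurable_const) hmeas hp

namespace RegularDynamics

theorem abs_apply_le (hf : RegularDynamics f U D L M) (x : E n) (p : E n →L[ℝ] ℝ) {u : E m}
    (hu : u ∈ U) {d : E w} (hd : d ∈ D) : |p (f x u d)| ≤ ‖p‖ * M :=
  (p.le_opNorm _).trans (mul_le_mul_of_nonneg_left (hf.norm_le x u hu d hd) (norm_nonneg _))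

theorem bddBelow_apply (hf : RegularDynamics f U D L M) (x : E n) (p : E n →L[ℝ] ℝ) (u : U) :
    BddBelow (range fun d : D => p (f x u d)) := by
  refine ⟨-(‖p‖ * M), ?_⟩
  rintro _ ⟨d, rfl⟩
  exact (abs_le.1 (hf.abs_apply_le x p u.2 d.2)).1

theorem bddAbove_iInf_apply (hf : RegularDynamics f U D L M) (x : E n) (p : E n →L[ℝ] ℝ) :
    BddAbove (range fun u : U => ⨅ d : D, p (f x u d)) := by
  refine ⟨‖p‖ * M, ?_⟩
  rintro _ ⟨u, rfl⟩
  obtain ⟨d, hd⟩ := hf.nonempty_right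
  exact (ciInf_le (hf.bddBelow_apply x p u) ⟨d, hd⟩).trans
    (abs_le.1 (hf.abs_apply_le x p u.2 hd)).2

theorem exists_lt_of_hamiltonian_lt (hf : RegularDynamics f U D L M) {p : E n →L[ℝ] ℝ} {b : ℝ}
    (h : hamiltonian f U D x p < b) : ∀ u ∈ U, ∃ d ∈ D, p (f x u d) < b := by
  intro u hu
  have : Nonempty D := hf.nonempty_right.to_subtype
  obtain ⟨d, hd⟩ := exists_lt_of_ciInf_lt
    ((le_ciSup (hf.bddAbove_iInf_apply x p) ⟨u, hu⟩).trans_lt h)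
  exact ⟨d, d.2, hd⟩

theorem exists_le_of_lt_hamiltonian (hf : RegularDynamics f U D L M) {p : E n →L[ℝ] ℝ} {b : ℝ}
    (h : b < hamiltonian f U D x p) : ∃ u ∈ U, ∀ d ∈ D, b ≤ p (f x u d) := by
  have : Nonempty U := hf.nonempty_left.to_subtype
  obtain ⟨u, hu⟩ := exists_lt_of_lt_ciSup h
  exact ⟨u, u.2, fun d hd => hu.le.trans (ciInf_le (hf.bddBelow_apply x p u) ⟨d, hd⟩)⟩

theorem hamiltonian_le_add (hf : RegularDynamics f U D L M) {x x' : E n} {p p' : E n →L[ℝ] ℝ}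
    {c : ℝ} (h : ∀ u ∈ U, ∀ d ∈ D, p (f x u d) ≤ p' (f x' u d) + c) :
    hamiltonian f U D x p ≤ hamiltonian f U D x' p' + c := by
  have : Nonempty U := hf.nonempty_left.to_subtype
  have : Nonempty D := hf.nonempty_right.to_subtype
  refine ciSup_le fun u => ?_
  rw [← sub_le_iff_le_add]
  refine le_trans ?_ (le_ciSup (hf.bddAbove_iInf_apply x' p') u)
  refine le_ciInf fun d => ?_
  rw [sub_le_iff_le_add]
  exact (ciInf_le (hf.bddBelow_apply x p u) d).trans (h u u.2 d d.2)

/-- Short trajectories stay in a given neighbourhood, uniformly in the inputs. -/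
theorem eventually_mem_of_mem_nhds (hf : RegularDynamics f U D L M) {S : Set (E n × ℝ)}
    (hS : S ∈ nhds (x, t)) : ∀ᶠ δ : ℝ in nhdsWithin 0 (Ioi 0), t + δ ≤ 0 →
      ∀ (u : Signal U t) (d : Signal D t) (y : ℝ → E n), IsTrajectory f x t u.1 d.1 y →
        ∀ s ∈ Icc t (t + δ), (y s, s) ∈ S := by
  obtain ⟨ρ, hρ, hball⟩ := Metric.mem_nhds_iff.1 hS
  have hM := hf.bound_nonneg
  -- With `M + 1` both displacements, $M\delta$ in space and $\delta$ in time, stay below `ρ`.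
  have h1 : ∀ᶠ δ : ℝ in nhdsWithin 0 (Ioi 0), δ < ρ / (M + 1) :=
    nhdsWithin_le_nhds (Iio_mem_nhds (by positivity))
  filter_upwards [h1, self_mem_nhdsWithin] with δ hδ hδ0 ht u d y hy s hs
  have hδ0 : 0 < δ := hδ0
  rw [lt_div_iff₀ (by positivity)] at hδ
  refine hball ?_
  rw [Metric.mem_ball, Prod.dist_eq, dist_eq_norm, Real.dist_eq]
  refine max_lt ?_ ?_
  · refine (hy.norm_sub_le hf ⟨hs.1, hs.2.trans ht⟩).trans_lt ?_
    nlinarith [hs.2]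
  · rw [abs_of_nonneg (sub_nonneg.2 hs.1)]
    nlinarith [hs.2]

/-- First order expansion of the discounted test function along trajectories, uniformly in the
inputs. -/
theorem eventually_abs_expansion_le (hf : RegularDynamics f U D L M) {φ : E n × ℝ → ℝ}
    (hφ : DifferentiableAt ℝ φ (x, t)) (γ : ℝ) {ε : ℝ} (hε : 0 < ε) :
    ∀ᶠ δ : ℝ in nhdsWithin 0 (Ioi 0), t + δ ≤ 0 →
      ∀ (u : Signal U t) (d : Signal D t) (y : ℝ → E n), IsTrajectory f x t u.1 d.1 y →
        |Real.exp (γ * (t + δ - t)) * φ (y (t + δ), t + δ) - (φ (x, t)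
          + δ * (fderiv ℝ φ (x, t) (0, 1) + γ * φ (x, t))
          + ∫ τ in t..t + δ, (fderiv ℝ φ (x, t)).comp (ContinuousLinearMap.inl ℝ (E n) ℝ)
              (f x (u.1 τ) (d.1 τ)))| ≤ ε * δ := by
  have hM := hf.bound_nonneg
  set p := (fderiv ℝ φ (x, t)).comp (ContinuousLinearMap.inl ℝ (E n) ℝ) with hp
  have hG : HasFDerivAt (fun q : E n × ℝ => Real.exp (γ * (q.2 - t)) * φ q)
      (Real.exp (γ * (t - t)) • fderiv ℝ φ (x, t) + φ (x, t) •
        (Real.exp (γ * (t - t)) • γ • ContinuousLinearMap.snd ℝ (E n) ℝ)) (x, t) := by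
    have h1 : HasFDerivAt (fun q : E n × ℝ => q.2) (ContinuousLinearMap.snd ℝ (E n) ℝ) (x, t) :=
      hasFDerivAt_snd
    exact (((h1.sub_const t).const_mul γ).exp).mul hφ.hasFDerivAt
  -- Half of `ε` pays for the differentiability remainder over a displacement of at most
  -- $(M+1)\delta$. The other half pays for replacing $f(\mathrm{x}(\tau),\cdot)$ by $f(x,\cdot)$,
  -- an error of $\|p\|LM\delta^2$.
  have hε₁ : 0 < ε / (2 * (M + 1)) := by positivity
  have hS := hG.isLittleO.def hε₁
  have h1 : ∀ᶠ δ : ℝ in nhdsWithin 0 (Ioi 0), δ < ε / (2 * (‖p‖ * L * M + 1)) :=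
    nhdsWithin_le_nhds (Iio_mem_nhds (by positivity))
  filter_upwards [hf.eventually_mem_of_mem_nhds hS, h1, self_mem_nhdsWithin]
    with δ hmem hδ hδ0 ht u d y hy
  have hδ0 : 0 < δ := hδ0
  have htδ : t ≤ t + δ := by linarith
  have ht0 : t ≤ 0 := htδ.trans ht
  have h2 := hmem ht u d y hy (t + δ) ⟨htδ, le_rfl⟩
  have hspeed : ∀ s ∈ Icc t (t + δ), ‖y s - x‖ ≤ M * δ := fun s hs =>
    (hy.norm_sub_le hf ⟨hs.1, hs.2.trans ht⟩).trans
      (mul_le_mul_of_nonneg_left (by linarith [hs.2]) hM)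
  have hnorm : ‖((y (t + δ), t + δ) : E n × ℝ) - (x, t)‖ ≤ (M + 1) * δ := by
    rw [Prod.mk_sub_mk, Prod.norm_mk, add_sub_cancel_left, Real.norm_eq_abs, abs_of_pos hδ0]
    exact max_le ((hspeed _ ⟨htδ, le_rfl⟩).trans (by nlinarith)) (by nlinarith)
  have hlin : fderiv ℝ φ (x, t) (y (t + δ) - x, δ)
      = p (y (t + δ) - x) + δ * fderiv ℝ φ (x, t) (0, 1) := by
    have : ((y (t + δ) - x, δ) : E n × ℝ) = (y (t + δ) - x, 0) + δ • ((0 : E n), (1 : ℝ)) := by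
      simp
    rw [this, map_add, map_smul, smul_eq_mul]
    rfl
  have hIy := hf.intervalIntegrable u d (hy.continuousOn ht0) le_rfl htδ ht
  have hIx := hf.intervalIntegrable u d (continuousOn_const (c := x)) le_rfl htδ ht
  have hint : |p (y (t + δ) - x) - ∫ τ in t..t + δ, p (f x (u.1 τ) (d.1 τ))|
      ≤ ‖p‖ * L * M * δ * δ := by
    rw [hy.2 _ ⟨htδ, ht⟩, add_sub_cancel_left, p.intervalIntegral_comp_comm hIx, ← map_sub,
      ← intervalIntegral.integral_sub hIy hIx]
    refine (p.le_opNorm _).trans ?_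
    have h3 := intervalIntegral.norm_integral_le_of_norm_le_const
      (f := fun τ => f (y τ) (u.1 τ) (d.1 τ) - f x (u.1 τ) (d.1 τ)) (a := t) (b := t + δ)
      (C := L * (M * δ)) (fun τ hτ => by
        rw [uIoc_of_le htδ] at hτ
        have hτ' : τ ∈ Icc t 0 := ⟨hτ.1.le, hτ.2.trans ht⟩
        exact (hf.norm_sub_le (u.2.2 τ hτ') (d.2.2 τ hτ') _ _).trans
          (mul_le_mul_of_nonneg_left (hspeed τ ⟨hτ.1.le, hτ.2⟩) L.2))
    rw [add_sub_cancel_left, abs_of_pos hδ0] at h3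
    calc _ ≤ ‖p‖ * (L * (M * δ) * δ) := mul_le_mul_of_nonneg_left h3 (norm_nonneg _)
      _ = _ := by ring
  have h4 : ‖p‖ * L * M * δ * δ ≤ ε / 2 * δ := by
    refine mul_le_mul_of_nonneg_right ?_ hδ0.le
    rw [lt_div_iff₀ (by positivity)] at hδ
    nlinarith
  have h5 : |Real.exp (γ * (t + δ - t)) * φ (y (t + δ), t + δ) - φ (x, t)
      - (p (y (t + δ) - x) + δ * fderiv ℝ φ (x, t) (0, 1) + φ (x, t) * (γ * δ))|
      ≤ ε / 2 * δ := by
    have h6 : ε / (2 * (M + 1)) * ((M + 1) * δ) = ε / 2 * δ := by field_simp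
    have h7 := h2.trans (mul_le_mul_of_nonneg_left hnorm hε₁.le)
    rw [h6] at h7
    simpa [hlin] using h7
  have h8 := abs_add_le (Real.exp (γ * (t + δ - t)) * φ (y (t + δ), t + δ) - φ (x, t)
      - (p (y (t + δ) - x) + δ * fderiv ℝ φ (x, t) (0, 1) + φ (x, t) * (γ * δ)))
    (p (y (t + δ) - x) - ∫ τ in t..t + δ, p (f x (u.1 τ) (d.1 τ)))
  refine le_trans (le_of_eq ?_) (h8.trans (by linarith))
  congr 1
  ring

end RegularDynamics

namespace RegularProblem

/-- If the differential expression were some $a<0$, a feedback nearly minimizing $p\cdot f(x,u,d)$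
for every $u$ would force the value strictly below $\phi(x,t)$ in a short time. -/
theorem value_subsolution (hp : RegularProblem f U D l γ L M K C) {φ : E n × ℝ → ℝ}
    (hφ : ContDiff ℝ 1 φ) (ht : t < 0) (h0 : value f U D l γ x t - φ (x, t) = 0)
    (hmax : IsLocalMax (fun p : E n × ℝ => value f U D l γ p.1 p.2 - φ p) (x, t)) :
    0 ≤ viOperator f U D l γ φ x t := by
  have hf := hp.toRegularDynamics
  refine le_min (by linarith [hp.value_le_cost ht.le x]) ?_
  set p := (fderiv ℝ φ (x, t)).comp (ContinuousLinearMap.inl ℝ (E n) ℝ) with hpdef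
  set H := hamiltonian f U D x p with hH
  by_contra! hneg
  set a := fderiv ℝ φ (x, t) (0, 1) + H + γ * φ (x, t) with ha
  -- One third of the slack goes to the selection and one third to the expansion; the last one
  -- remains as the strict decrease $\delta a/3$.
  have hε : 0 < -a / 3 := by linarith
  obtain ⟨c, hc, hcU, hcb⟩ := exists_measurable_selection hf.isCompact_left.measurableSet
    hf.nonempty_right (F := fun q : E m × E w => p (f x q.1 q.2))
    (p.continuous.comp_continuousOn (hf.continuousOn x)) (b := H + -a / 3)
    (hf.exists_lt_of_hamiltonian_lt (by linarith))
  have hS : {q : E n × ℝ | value f U D l γ q.1 q.2 - φ q ≤ 0} ∈ nhds (x, t) := by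
    filter_upwards [hmax] with q hq
    exact hq.trans h0.le
  have hsmall : ∀ᶠ δ : ℝ in nhdsWithin 0 (Ioi 0), t + δ ≤ 0 := by
    filter_upwards [nhdsWithin_le_nhds (Iio_mem_nhds (neg_pos.2 ht))] with δ hδ
    linarith [mem_Iio.1 hδ]
  obtain ⟨δ, h1, h2, h3, hδ⟩ := ((hf.eventually_abs_expansion_le
    ((hφ.differentiable one_ne_zero) (x, t)) γ hε).and ((hf.eventually_mem_of_mem_nhds hS).and
      (hsmall.and self_mem_nhdsWithin))).exists
  have hδ : 0 < δ := hδ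
  have hr : t + δ ∈ Icc t 0 := ⟨by linarith, h3⟩
  have : value f U D l γ x t ≤ φ (x, t) + δ * (a / 3) := by
    refine hp.value_le_of_feedback hr c hc hcU fun u y hy => ?_
    have h4 := (abs_le.1 (h1 h3 u _ y hy)).2
    have h5 : value f U D l γ (y (t + δ)) (t + δ) - φ (y (t + δ), t + δ) ≤ 0 :=
      h2 h3 u _ y hy (t + δ) ⟨hr.1, le_rfl⟩
    have h6 : ∫ τ in t..t + δ, p (f x (u.1 τ) ((u.feedback c hc hcU).1 τ))
        ≤ δ * (H + -a / 3) := by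
      have hI := hf.intervalIntegrable u (u.feedback c hc hcU) (continuousOn_const (c := x)) le_rfl
        hr.1 h3
      have := intervalIntegral.integral_mono_on hr.1
        ⟨p.integrable_comp hI.1, p.integrable_comp hI.2⟩
        (intervalIntegrable_const (c := H + -a / 3)) (fun τ hτ =>
          (hcb (u.1 τ) (u.2.2 τ ⟨hτ.1, hτ.2.trans h3⟩)).le)
      rwa [intervalIntegral.integral_const, add_sub_cancel_left, smul_eq_mul] at this
    have h7 := mul_le_mul_of_nonneg_left (sub_nonpos.1 h5) (Real.exp_nonneg (γ * (t + δ - t)))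
    have h8 : δ * a = δ * (fderiv ℝ φ (x, t) (0, 1) + γ * φ (x, t)) + δ * H := by rw [ha]; ring
    linarith
  have h9 := mul_neg_of_pos_of_neg hδ hneg
  linarith

/-- If both entries of the minimum were positive, a constant control nearly attaining the
Hamiltonian would push the value above $\phi(x,t)$, with the obstacle inactive for a short time. -/
theorem value_supersolution (hp : RegularProblem f U D l γ L M K C) {φ : E n × ℝ → ℝ}
    (hφ : ContDiff ℝ 1 φ) (ht : t < 0) (h0 : value f U D l γ x t - φ (x, t) = 0)
    (hmin : IsLocalMin (fun p : E n × ℝ => value f U D l γ p.1 p.2 - φ p) (x, t)) :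
    viOperator f U D l γ φ x t ≤ 0 := by
  have hf := hp.toRegularDynamics
  by_contra! hpos
  obtain ⟨hl, hpos⟩ := lt_min_iff.1 hpos
  set p := (fderiv ℝ φ (x, t)).comp (ContinuousLinearMap.inl ℝ (E n) ℝ) with hpdef
  set H := hamiltonian f U D x p with hH
  set a := fderiv ℝ φ (x, t) (0, 1) + H + γ * φ (x, t) with ha
  have hε : 0 < a / 3 := by linarith
  obtain ⟨v, hv, hvb⟩ := hf.exists_le_of_lt_hamiltonian (x := x) (p := p) (b := H - a / 3)
    (by linarith)
  have hS : {q : E n × ℝ | 0 ≤ value f U D l γ q.1 q.2 - φ q} ∈ nhds (x, t) := by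
    filter_upwards [hmin] with q hq
    exact h0.ge.trans hq
  -- The midpoint between $\phi(x,t)$ and $l(x)$ leaves room both for the variation of the running
  -- cost and, through `hsmall'`, for the gain $\delta a/3$.
  have hS' : {q : E n × ℝ | (φ (x, t) + l x) / 2 < Real.exp (γ * (q.2 - t)) * l q.1}
      ∈ nhds (x, t) := by
    have hc : Continuous fun q : E n × ℝ => Real.exp (γ * (q.2 - t)) * l q.1 := by
      have := hp.lipschitz_cost.continuous
      fun_prop
    refine (isOpen_lt continuous_const hc).mem_nhds ?_
    simp only [mem_ofPred_eq, sub_self, mul_zero, Real.exp_zero, one_mul]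
    linarith
  have hsmall : ∀ᶠ δ : ℝ in nhdsWithin 0 (Ioi 0), t + δ ≤ 0 := by
    filter_upwards [nhdsWithin_le_nhds (Iio_mem_nhds (neg_pos.2 ht))] with δ hδ
    linarith [mem_Iio.1 hδ]
  have hsmall' : ∀ᶠ δ : ℝ in nhdsWithin 0 (Ioi 0), δ < (l x - φ (x, t)) / 2 / (a / 3) :=
    nhdsWithin_le_nhds (Iio_mem_nhds (by positivity))
  obtain ⟨δ, h1, h2, h2', h3, h3', hδ⟩ := ((hf.eventually_abs_expansion_le
    ((hφ.differentiable one_ne_zero) (x, t)) γ hε).and ((hf.eventually_mem_of_mem_nhds hS).and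
      ((hf.eventually_mem_of_mem_nhds hS').and
      (hsmall.and (hsmall'.and self_mem_nhdsWithin))))).exists
  have hδ : 0 < δ := hδ
  rw [lt_div_iff₀ hε] at h3'
  have hr : t + δ ∈ Icc t 0 := ⟨by linarith, h3⟩
  have : φ (x, t) + δ * (a / 3) ≤ value f U D l γ x t := by
    refine hp.le_value_of_const hr hv (fun d y hy s hs => ?_) fun d y hy => ?_
    · have h4 : (φ (x, t) + l x) / 2 < Real.exp (γ * (s - t)) * l (y s) :=
        h2' h3 _ d y hy s hs
      linarith
    have h4 := (abs_le.1 (h1 h3 _ d y hy)).1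
    have h5 : 0 ≤ value f U D l γ (y (t + δ)) (t + δ) - φ (y (t + δ), t + δ) :=
      h2 h3 _ d y hy (t + δ) ⟨hr.1, le_rfl⟩
    have h6 : δ * (H - a / 3) ≤
        ∫ τ in t..t + δ, p (f x ((Signal.const t v hv).1 τ) (d.1 τ)) := by
      have hI := hf.intervalIntegrable (Signal.const t v hv) d (continuousOn_const (c := x)) le_rfl
        hr.1 h3
      have := intervalIntegral.integral_mono_on hr.1
        (intervalIntegrable_const (c := H - a / 3)) ⟨p.integrable_comp hI.1, p.integrable_comp hI.2⟩
        (fun τ hτ => hvb (d.1 τ) (d.2.2 τ ⟨hτ.1, hτ.2.trans h3⟩))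
      rwa [intervalIntegral.integral_const, add_sub_cancel_left, smul_eq_mul] at this
    have h7 := mul_le_mul_of_nonneg_left (sub_nonneg.1 h5) (Real.exp_nonneg (γ * (t + δ - t)))
    have h8 : δ * a = δ * (fderiv ℝ φ (x, t) (0, 1) + γ * φ (x, t)) + δ * H := by rw [ha]; ring
    linarith
  have h9 := mul_pos hδ hε
  linarith

theorem isViscositySolution_value (hp : RegularProblem f U D l γ L M K C) :
    IsViscositySolution f U D l γ (value f U D l γ) where
  continuousOn := hp.continuousOn_value
  subsolution _ hφ _ _ ht h0 hmax := hp.value_subsolution hφ ht h0 hmax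
  supersolution _ hφ _ _ ht h0 hmin := hp.value_supersolution hφ ht h0 hmin

end RegularProblem

end CBVF

/-! ### Doubling of variables, penalty and exponential rescaling -/

namespace CBVF

/-- Doubling of variables with a penalty `d` on a compact set: penalized maximizers concentrate at a
maximizer on the diagonal. -/
theorem exists_doubling {X : Type*} [PseudoMetricSpace X] {S : Set X} (hS : IsCompact S)
    (hne : S.Nonempty) {v w : X → ℝ} (hv : ContinuousOn v S) (hw : ContinuousOn w S)
    {d : X → X → ℝ} (hd : Continuous fun p : X × X => d p.1 p.2) (hd0 : ∀ p q, 0 ≤ d p q)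
    (hd_self : ∀ p, d p p = 0) (hd_eq : ∀ p q, d p q = 0 → p = q) :
    ∃ z ∈ S, (∀ p ∈ S, v p - w p ≤ v z - w z) ∧ ∀ N ∈ nhds z, ∀ ε > 0, ∃ k : ℝ, 0 ≤ k ∧
      ∃ p ∈ N ∩ S, ∃ q ∈ N ∩ S, k * d p q < ε ∧ ∀ p' ∈ S, ∀ q' ∈ S,
        v p' - w q' - k * d p' q' ≤ v p - w q - k * d p q := by
  obtain ⟨z₀, hz₀, hmax₀⟩ := hS.exists_isMaxOn hne (hv.sub hw)
  have hF : ContinuousOn (fun p : X × X => v p.1 - w p.2) (S ×ˢ S) :=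
    (hv.comp continuousOn_fst fun p hp => hp.1).sub (hw.comp continuousOn_snd fun p hp => hp.2)
  have hex : ∀ k : ℕ, ∃ P ∈ S ×ˢ S, ∀ Q ∈ S ×ˢ S,
      v Q.1 - w Q.2 - ((k : ℝ) + 1) * d Q.1 Q.2 ≤ v P.1 - w P.2 - ((k : ℝ) + 1) * d P.1 P.2 :=
    fun k => (hS.prod hS).exists_isMaxOn (hne.prod hne)
      (hF.sub (continuous_const.mul hd).continuousOn)
  choose P hPS hP using hex
  obtain ⟨⟨z, z'⟩, hz, θ, hθ, hlim⟩ := (hS.prod hS).tendsto_subseq hPS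
  have hlimF : Filter.Tendsto (fun j => v (P (θ j)).1 - w (P (θ j)).2) Filter.atTop
      (nhds (v z - w z')) :=
    (hF (z, z') hz).tendsto.comp
      (tendsto_nhdsWithin_iff.2 ⟨hlim, Filter.Eventually.of_forall fun j => hPS _⟩)
  have hlimd : Filter.Tendsto (fun j => d (P (θ j)).1 (P (θ j)).2) Filter.atTop
      (nhds (d z z')) := (hd.tendsto (z, z')).comp hlim
  have hbound : ∀ k : ℕ, ((k : ℝ) + 1) * d (P k).1 (P k).2 ≤
      v (P k).1 - w (P k).2 - (v z₀ - w z₀) := fun k => by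
    have := hP k (z₀, z₀) ⟨hz₀, hz₀⟩
    simp only [hd_self, mul_zero, sub_zero] at this
    linarith
  -- The penalty times $k+1$ is bounded by a convergent sequence, so the penalty itself tends to 0
  -- and the limit is diagonal.
  have hzz : z = z' := by
    refine hd_eq _ _ (le_antisymm ?_ (hd0 _ _))
    have h1 : Filter.Tendsto (fun j => (v (P (θ j)).1 - w (P (θ j)).2 - (v z₀ - w z₀)) *
        (1 / ((θ j : ℝ) + 1))) Filter.atTop (nhds ((v z - w z' - (v z₀ - w z₀)) * 0)) :=
      (hlimF.sub_const _).mul (tendsto_one_div_add_atTop_nhds_zero_nat.comp hθ.tendsto_atTop)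
    rw [mul_zero] at h1
    refine le_of_tendsto_of_tendsto' hlimd h1 fun j => ?_
    rw [mul_one_div, le_div_iff₀ (by positivity), mul_comm]
    exact hbound _
  subst hzz
  refine ⟨z, hz.1, fun p hp => ?_, fun N hN ε hε => ?_⟩
  · refine ge_of_tendsto' hlimF fun j => ?_
    have h1 := hbound (θ j)
    have h2 : v p - w p ≤ v z₀ - w z₀ := hmax₀ hp
    have h3 : 0 ≤ ((θ j : ℝ) + 1) * d (P (θ j)).1 (P (θ j)).2 :=
      mul_nonneg (by positivity) (hd0 _ _)
    linarith
  -- Maximality of `z₀` makes the limit of the upper bound `hbound` nonpositive, so the penalty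
  -- terms eventually fall below `ε`.
  · have hle : v z - w z - (v z₀ - w z₀) < ε := by
      have h2 : v z - w z ≤ v z₀ - w z₀ := hmax₀ hz.1
      linarith
    have h1 := (hlimF.sub_const (v z₀ - w z₀)).eventually_lt_const hle
    have h2 := (continuous_fst.tendsto (z, z)).comp hlim |>.eventually_mem hN
    have h3 := (continuous_snd.tendsto (z, z)).comp hlim |>.eventually_mem hN
    obtain ⟨j, hj1, hj2, hj3⟩ := (h1.and (h2.and h3)).exists
    exact ⟨(θ j : ℝ) + 1, by positivity, (P (θ j)).1, ⟨hj2, (hPS _).1⟩, (P (θ j)).2,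
      ⟨hj3, (hPS _).2⟩, (hbound _).trans_lt hj1, fun p' hp' q' hq' => hP _ (p', q') ⟨hp', hq'⟩⟩

variable {n m w : ℕ}

/-- A smooth penalty that decreases along all space-time directions of speed at most `M` and is large
away from a backward-widening neighbourhood of `(x₀, t₀)`. -/
theorem exists_penalty (x₀ : E n) (t₀ : ℝ) {M A : ℝ} (hA : 0 ≤ A) (η : ℝ) :
    ∃ ψ : E n × ℝ → ℝ, ContDiff ℝ 1 ψ ∧
      (∀ q, ∀ z : E n, ‖z‖ ≤ M → fderiv ℝ ψ q (z, 1) ≤ -η) ∧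
      (ψ (x₀, t₀) = -(η * t₀)) ∧ (∀ q, -(η * q.2) ≤ ψ q) ∧
      (∀ q, M * (q.2 - t₀) + 3 ≤ ‖q.1 - x₀‖ → A - η * q.2 ≤ ψ q) ∧
      (∀ q, q.2 ≤ t₀ - 1 → A - η * q.2 ≤ ψ q) := by
  let σ := Real.smoothTransition
  have hσ : ContDiff ℝ 1 σ := Real.smoothTransition.contDiff
  -- The square root is a smooth substitute for the norm with gradient of norm at most 1, so `g`
  -- does not increase at speeds up to `M`. The shift by 2 gives $g(x_0,t_0)=-1$ and $g\ge1$ once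
  -- $\|x-x_0\|\ge M(t-t_0)+3$.
  let g : E n × ℝ → ℝ := fun q => Real.sqrt (1 + ‖q.1 - x₀‖ ^ 2) - M * (q.2 - t₀) - 2
  have hpos : ∀ q : E n × ℝ, 0 < 1 + ‖q.1 - x₀‖ ^ 2 := fun q => by positivity
  have hg : ContDiff ℝ 1 g := by
    have h1 : ContDiff ℝ 1 fun q : E n × ℝ => 1 + ‖q.1 - x₀‖ ^ 2 :=
      contDiff_const.add ((contDiff_fst.sub contDiff_const).norm_sq ℝ)
    have h2 := h1.sqrt fun q => (hpos q).ne'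
    exact (h2.sub (by fun_prop)).sub contDiff_const
  have hg' : ∀ q, ∀ z : E n, ‖z‖ ≤ M → fderiv ℝ g q (z, 1) ≤ 0 := by
    intro q z hz
    have h1 : HasFDerivAt (fun q : E n × ℝ => q.1 - x₀) (ContinuousLinearMap.fst ℝ (E n) ℝ) q :=
      hasFDerivAt_fst.sub_const x₀
    have h2 : HasFDerivAt (fun q : E n × ℝ => q.2 - t₀) (ContinuousLinearMap.snd ℝ (E n) ℝ) q :=
      hasFDerivAt_snd.sub_const t₀
    have h3 := (((h1.norm_sq.const_add 1).sqrt (hpos q).ne').sub (h2.const_mul M)).sub_const 2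
    have h3' : fderiv ℝ g q = _ := h3.fderiv
    rw [h3']
    have hs : 0 < Real.sqrt (1 + ‖q.1 - x₀‖ ^ 2) := Real.sqrt_pos.2 (hpos q)
    have h4 : inner ℝ (q.1 - x₀) z ≤ Real.sqrt (1 + ‖q.1 - x₀‖ ^ 2) * M := by
      refine (real_inner_le_norm _ _).trans (mul_le_mul ?_ hz (norm_nonneg _) hs.le)
      exact Real.le_sqrt_of_sq_le (by linarith)
    have h5 : (Real.sqrt (1 + ‖q.1 - x₀‖ ^ 2))⁻¹ * inner ℝ (q.1 - x₀) z ≤ M := by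
      rwa [inv_mul_le_iff₀ hs]
    simp only [_root_.sub_apply, _root_.smul_apply,
      ContinuousLinearMap.comp_apply, ContinuousLinearMap.coe_fst', ContinuousLinearMap.coe_snd',
      innerSL_apply_apply, smul_eq_mul, nsmul_eq_mul]
    push_cast
    rw [mul_one, show ∀ a b : ℝ, 1 / (2 * a) * (2 * b) = a⁻¹ * b by intro a b; field_simp]
    linarith
  have hσ' : ∀ r, HasDerivAt σ (deriv σ r) r := fun r =>
    ((hσ.differentiable one_ne_zero) r).hasDerivAt
  have hσ0 : ∀ r, 0 ≤ deriv σ r := fun r => Real.smoothTransition.monotone.deriv_nonneg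
  have hone : ∀ {r}, 1 ≤ r → σ r = 1 := Real.smoothTransition.one_of_one_le
  have hzero : ∀ {r}, r ≤ 0 → σ r = 0 := Real.smoothTransition.zero_of_nonpos
  have hnn : ∀ r, 0 ≤ A * σ r := fun r => mul_nonneg hA (Real.smoothTransition.nonneg r)
  -- The first term is the lateral barrier, the second the barrier at times before $t_0-1$; both are
  -- nonincreasing in the directions considered. The term $-\eta t$ makes the decrease strict.
  refine ⟨fun q => A * σ (g q) + A * σ (t₀ - q.2) - η * q.2, ?_, ?_, ?_, ?_, ?_, ?_⟩
  · exact ((contDiff_const.mul (hσ.comp hg)).add (contDiff_const.mul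
      (hσ.comp (contDiff_const.sub contDiff_snd)))).sub (contDiff_const.mul contDiff_snd)
  · intro q z hz
    have h2 : HasFDerivAt (fun q : E n × ℝ => q.2) (ContinuousLinearMap.snd ℝ (E n) ℝ) q :=
      hasFDerivAt_snd
    have h3 := ((((hσ' _).comp_hasFDerivAt q
      ((hg.differentiable one_ne_zero) q).hasFDerivAt).const_mul A).add
      (((hσ' _).comp_hasFDerivAt q (h2.const_sub t₀)).const_mul A)).sub (h2.const_mul η)
    have h4 : fderiv ℝ (fun q => A * σ (g q) + A * σ (t₀ - q.2) - η * q.2) q = _ := h3.fderiv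
    rw [h4]
    simp only [_root_.sub_apply, _root_.add_apply,
      _root_.smul_apply, _root_.neg_apply,
      ContinuousLinearMap.coe_snd', smul_eq_mul]
    have h5 := mul_nonneg hA (mul_nonneg (hσ0 (g q)) (neg_nonneg.2 (hg' q z hz)))
    have h6 := mul_nonneg hA (hσ0 (t₀ - q.2))
    linarith
  · have h1 : g (x₀, t₀) ≤ 0 := by simp [g]
    simp [hzero h1, hzero le_rfl]
  · intro q
    linarith [hnn (g q), hnn (t₀ - q.2)]
  · intro q hq
    have h1 : 1 ≤ g q := by
      have : ‖q.1 - x₀‖ ≤ Real.sqrt (1 + ‖q.1 - x₀‖ ^ 2) := Real.le_sqrt_of_sq_le (by linarith)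
      simp only [g]
      linarith
    have := hnn (t₀ - q.2)
    simp only [hone h1]
    linarith
  · intro q hq
    have := hnn (g q)
    simp only [hone (show 1 ≤ t₀ - q.2 by linarith)]
    linarith

variable {f : E n → E m → E w → E n} {U : Set (E m)} {D : Set (E w)} {l : E n → ℝ} {γ : ℝ}
  {L : NNReal} {M : ℝ} {K : NNReal} {C : ℝ} {x : E n} {t : ℝ}

theorem hamiltonian_smul {a : ℝ} (ha : 0 ≤ a) (x : E n) (p : E n →L[ℝ] ℝ) :
    hamiltonian f U D x (a • p) = a * hamiltonian f U D x p := by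
  unfold hamiltonian
  rw [Real.mul_iSup_of_nonneg ha]
  congr 1
  funext u
  rw [Real.mul_iInf_of_nonneg ha]
  rfl

/-- The variational inequality operator at a test function of the form `e^{-γ t} (φ + c)`. -/
theorem viOperator_exp_mul {φ : E n × ℝ → ℝ} (hφ : DifferentiableAt ℝ φ (x, t)) (c : ℝ) :
    viOperator f U D l γ (fun q => Real.exp (-(γ * q.2)) * (φ q + c)) x t =
      min (l x - Real.exp (-(γ * t)) * (φ (x, t) + c))
        (Real.exp (-(γ * t)) * (fderiv ℝ φ (x, t) (0, 1) + hamiltonian f U D x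
          ((fderiv ℝ φ (x, t)).comp (ContinuousLinearMap.inl ℝ (E n) ℝ)))) := by
  have h1 : HasFDerivAt (fun q : E n × ℝ => q.2) (ContinuousLinearMap.snd ℝ (E n) ℝ) (x, t) :=
    hasFDerivAt_snd
  have h2 := ((h1.const_mul γ).fun_neg.exp).fun_mul (hφ.hasFDerivAt.add_const c)
  have h3 : (fderiv ℝ (fun q : E n × ℝ => Real.exp (-(γ * q.2)) * (φ q + c)) (x, t)).comp
      (ContinuousLinearMap.inl ℝ (E n) ℝ) = Real.exp (-(γ * t)) •
        (fderiv ℝ φ (x, t)).comp (ContinuousLinearMap.inl ℝ (E n) ℝ) := by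
    rw [h2.fderiv]
    ext z
    simp
  unfold viOperator
  rw [h3, hamiltonian_smul (Real.exp_nonneg _), h2.fderiv]
  congr 1
  simp only [_root_.add_apply, _root_.smul_apply,
    _root_.neg_apply, ContinuousLinearMap.coe_snd', smul_eq_mul]
  ring

namespace IsViscositySolution

variable {W : E n → ℝ → ℝ} {φ : E n × ℝ → ℝ}

theorem contDiff_exp_mul (hφ : ContDiff ℝ 1 φ) (γ c : ℝ) :
    ContDiff ℝ 1 fun q : E n × ℝ => Real.exp (-(γ * q.2)) * (φ q + c) :=
  ((contDiff_const.mul contDiff_snd).neg.exp).mul (hφ.add contDiff_const)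

theorem exp_neg_mul_cancel (a b : ℝ) : Real.exp (-a) * (Real.exp a * b) = b := by
  rw [← mul_assoc, ← Real.exp_add]
  simp

/-- A test function $\phi$ for $e^{\gamma t}W$ corresponds to the test function $e^{-\gamma
t}(\phi+c)$ for $W$, where $c$ makes the values match. The $\gamma$ terms cancel and the positive
factor $e^{-\gamma t}$ drops out. -/
theorem exp_subsolution (hW : IsViscositySolution f U D l γ W) (hφ : ContDiff ℝ 1 φ) (ht : t < 0)
    (hmax : IsLocalMax (fun q : E n × ℝ => Real.exp (γ * q.2) * W q.1 q.2 - φ q) (x, t)) :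
    W x t ≤ l x ∧ 0 ≤ fderiv ℝ φ (x, t) (0, 1) + hamiltonian f U D x
      ((fderiv ℝ φ (x, t)).comp (ContinuousLinearMap.inl ℝ (E n) ℝ)) := by
  set c := Real.exp (γ * t) * W x t - φ (x, t) with hc
  have hval : Real.exp (-(γ * t)) * (φ (x, t) + c) = W x t := by
    rw [hc, add_sub_cancel, exp_neg_mul_cancel]
  have h := hW.subsolution _ (contDiff_exp_mul hφ γ c) x t ht (by simp only [hval, sub_self]) (by
    filter_upwards [hmax] with q hq
    simp only [hval, sub_self]
    have h1 : W q.1 q.2 - Real.exp (-(γ * q.2)) * (φ q + c) =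
        Real.exp (-(γ * q.2)) * (Real.exp (γ * q.2) * W q.1 q.2 - φ q - c) := by
      conv_lhs => rw [← exp_neg_mul_cancel (γ * q.2) (W q.1 q.2)]
      ring
    rw [h1]
    exact mul_nonpos_of_nonneg_of_nonpos (Real.exp_nonneg _) (sub_nonpos.2 hq))
  rw [viOperator_exp_mul ((hφ.differentiable one_ne_zero) _), le_min_iff, hval] at h
  exact ⟨sub_nonneg.1 h.1, nonneg_of_mul_nonneg_right h.2 (Real.exp_pos _)⟩

theorem exp_supersolution (hW : IsViscositySolution f U D l γ W) (hφ : ContDiff ℝ 1 φ) (ht : t < 0)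
    (hmin : IsLocalMin (fun q : E n × ℝ => Real.exp (γ * q.2) * W q.1 q.2 - φ q) (x, t)) :
    l x ≤ W x t ∨ fderiv ℝ φ (x, t) (0, 1) + hamiltonian f U D x
      ((fderiv ℝ φ (x, t)).comp (ContinuousLinearMap.inl ℝ (E n) ℝ)) ≤ 0 := by
  set c := Real.exp (γ * t) * W x t - φ (x, t) with hc
  have hval : Real.exp (-(γ * t)) * (φ (x, t) + c) = W x t := by
    rw [hc, add_sub_cancel, exp_neg_mul_cancel]
  have h := hW.supersolution _ (contDiff_exp_mul hφ γ c) x t ht (by simp only [hval, sub_self]) (by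
    filter_upwards [hmin] with q hq
    simp only [hval, sub_self]
    have h1 : W q.1 q.2 - Real.exp (-(γ * q.2)) * (φ q + c) =
        Real.exp (-(γ * q.2)) * (Real.exp (γ * q.2) * W q.1 q.2 - φ q - c) := by
      conv_lhs => rw [← exp_neg_mul_cancel (γ * q.2) (W q.1 q.2)]
      ring
    rw [h1]
    exact mul_nonneg (Real.exp_nonneg _) (sub_nonneg.2 hq))
  rw [viOperator_exp_mul ((hφ.differentiable one_ne_zero) _), min_le_iff, hval] at h
  exact h.imp sub_nonpos.1 fun h => nonpos_of_mul_nonpos_right h (Real.exp_pos _)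

end IsViscositySolution

/-- The derivative of the squared distance in space-time. -/
theorem hasFDerivAt_sq_dist (p q : E n × ℝ) :
    HasFDerivAt (fun p : E n × ℝ => ‖p.1 - q.1‖ ^ 2 + (p.2 - q.2) ^ 2)
      ((2 : ℝ) • (innerSL ℝ (p.1 - q.1)).comp (ContinuousLinearMap.fst ℝ (E n) ℝ)
        + (2 * (p.2 - q.2)) • ContinuousLinearMap.snd ℝ (E n) ℝ) p := by
  have h1 : HasFDerivAt (fun p : E n × ℝ => p.1 - q.1) (ContinuousLinearMap.fst ℝ (E n) ℝ) p :=
    hasFDerivAt_fst.sub_const q.1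
  have h2 : HasFDerivAt (fun p : E n × ℝ => p.2 - q.2) (ContinuousLinearMap.snd ℝ (E n) ℝ) p :=
    hasFDerivAt_snd.sub_const q.2
  refine (h1.norm_sq.add (h2.pow 2)).congr_fderiv ?_
  ext z <;> simp

end CBVF

/-! ### Comparison principle -/

namespace CBVF

variable {n m w : ℕ} {f : E n → E m → E w → E n} {U : Set (E m)} {D : Set (E w)} {l : E n → ℝ}
  {γ : ℝ} {L : NNReal} {M : ℝ} {W₁ W₂ : E n → ℝ → ℝ}

/-- The pair of viscosity inequalities at a maximizer of the doubled problem is contradictory once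
the penalty dominates. -/
theorem doubled_inequalities_false (hf : RegularDynamics f U D L M)
    (h₁ : IsViscositySolution f U D l γ W₁) (h₂ : IsViscositySolution f U D l γ W₂)
    {ψ : E n × ℝ → ℝ} (hψ : ContDiff ℝ 1 ψ) {η : ℝ}
    (hψ' : ∀ q, ∀ z : E n, ‖z‖ ≤ M → fderiv ℝ ψ q (z, 1) ≤ -η) {k : ℝ} (hk : 0 ≤ k)
    {p q : E n × ℝ} (hp : p.2 < 0) (hq : q.2 < 0)
    (hkd : 2 * L * (k * (‖p.1 - q.1‖ ^ 2 + (p.2 - q.2) ^ 2)) < η)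
    (hmax : IsLocalMax (fun p' : E n × ℝ => Real.exp (γ * p'.2) * W₁ p'.1 p'.2
      - (ψ p' + k * (‖p'.1 - q.1‖ ^ 2 + (p'.2 - q.2) ^ 2))) p)
    (hmin : IsLocalMin (fun q' : E n × ℝ => Real.exp (γ * q'.2) * W₂ q'.1 q'.2
      - -(k * (‖q'.1 - p.1‖ ^ 2 + (q'.2 - p.2) ^ 2))) q)
    (hobs : W₁ p.1 p.2 ≤ l p.1 → W₂ q.1 q.2 < l q.1) : False := by
  have hd : ∀ c : E n × ℝ, ContDiff ℝ 1
      fun p : E n × ℝ => ‖p.1 - c.1‖ ^ 2 + (p.2 - c.2) ^ 2 := fun c =>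
    ((contDiff_fst.sub contDiff_const).norm_sq ℝ).add ((contDiff_snd.sub contDiff_const).pow 2)
  obtain ⟨hle, hsub⟩ := h₁.exp_subsolution (x := p.1) (t := p.2)
    (hψ.add (contDiff_const.mul (hd q))) hp hmax
  have hsup := (h₂.exp_supersolution (x := q.1) (t := q.2)
    (contDiff_const.mul (hd p)).neg hq hmin).resolve_left (hobs hle).not_ge
  have hD₁ : HasFDerivAt (fun p' => ψ p' + k * (‖p'.1 - q.1‖ ^ 2 + (p'.2 - q.2) ^ 2)) _ p :=
    ((hψ.differentiable one_ne_zero) p).hasFDerivAt.add ((hasFDerivAt_sq_dist p q).const_mul k)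
  have hD₂ : HasFDerivAt (fun q' => -(k * (‖q'.1 - p.1‖ ^ 2 + (q'.2 - p.2) ^ 2))) _ q :=
    ((hasFDerivAt_sq_dist q p).const_mul k).neg
  rw [hD₁.fderiv] at hsub
  rw [hD₂.fderiv] at hsup
  -- The quadratic penalty contributes the same covector $2k(p_1-q_1)$ at both points. In `c`, the
  -- part $-\eta-D_t\psi$ comes from the decrease of `ψ`, the rest from the Lipschitz bound on `f`.
  have hH := hf.hamiltonian_le_add (x := p.1) (x' := q.1)
    (p := (fderiv ℝ ψ p + k • ((2 : ℝ) •
      (innerSL ℝ (p.1 - q.1)).comp (ContinuousLinearMap.fst ℝ (E n) ℝ)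
        + (2 * (p.2 - q.2)) • ContinuousLinearMap.snd ℝ (E n) ℝ)).comp
          (ContinuousLinearMap.inl ℝ (E n) ℝ))
    (p' := (-(k • ((2 : ℝ) •
      (innerSL ℝ (q.1 - p.1)).comp (ContinuousLinearMap.fst ℝ (E n) ℝ)
        + (2 * (q.2 - p.2)) • ContinuousLinearMap.snd ℝ (E n) ℝ))).comp
          (ContinuousLinearMap.inl ℝ (E n) ℝ))
    (c := -η - fderiv ℝ ψ p (0, 1) + 2 * L * (k * ‖p.1 - q.1‖ ^ 2)) (by
      intro u hu d hd
      have h3 := hψ' p _ (hf.norm_le p.1 u hu d hd)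
      have h4 : fderiv ℝ ψ p (f p.1 u d, 1)
          = fderiv ℝ ψ p (f p.1 u d, 0) + fderiv ℝ ψ p (0, 1) := by
        rw [← map_add]; simp
      have h5 : inner ℝ (p.1 - q.1) (f p.1 u d) - inner ℝ (p.1 - q.1) (f q.1 u d)
          ≤ L * ‖p.1 - q.1‖ ^ 2 := by
        rw [← inner_sub_right]
        refine (real_inner_le_norm _ _).trans ?_
        have := mul_le_mul_of_nonneg_left (hf.norm_sub_le hu hd p.1 q.1)
          (norm_nonneg (p.1 - q.1))
        linarith
      have h6 := mul_le_mul_of_nonneg_left h5 hk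
      have h7 : inner ℝ (q.1 - p.1) (f q.1 u d) = -inner ℝ (p.1 - q.1) (f q.1 u d) := by
        rw [← inner_neg_left, neg_sub]
      simp only [ContinuousLinearMap.comp_apply, _root_.add_apply, _root_.smul_apply,
        _root_.neg_apply, ContinuousLinearMap.inl_apply, ContinuousLinearMap.coe_fst',
        ContinuousLinearMap.coe_snd', innerSL_apply_apply, smul_eq_mul, h7]
      linarith)
  -- The time derivatives of the quadratic penalty cancel between the two inequalities; its time
  -- part in `hkd` is only discarded.
  have h8 : 0 ≤ 2 * L * (k * (p.2 - q.2) ^ 2) := by positivity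
  simp only [_root_.add_apply, _root_.smul_apply, _root_.neg_apply, ContinuousLinearMap.comp_apply,
    ContinuousLinearMap.coe_fst', ContinuousLinearMap.coe_snd', map_zero, smul_eq_mul] at hsub hsup
  linarith

/-- Comparison principle. Finite speed of propagation makes growth conditions unnecessary. -/
theorem IsViscositySolution.le_of_terminal_le (hf : RegularDynamics f U D L M) (hl : Continuous l)
    (h₁ : IsViscositySolution f U D l γ W₁) (h₂ : IsViscositySolution f U D l γ W₂)
    (h0 : ∀ x, W₁ x 0 ≤ W₂ x 0) (x₀ : E n) {t₀ : ℝ} (ht₀ : t₀ ≤ 0) : W₁ x₀ t₀ ≤ W₂ x₀ t₀ := by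
  by_contra! hlt
  have hM := hf.bound_nonneg
  let V₁ : E n × ℝ → ℝ := fun q => Real.exp (γ * q.2) * W₁ q.1 q.2
  let V₂ : E n × ℝ → ℝ := fun q => Real.exp (γ * q.2) * W₂ q.1 q.2
  have hexp : Continuous fun q : E n × ℝ => Real.exp (γ * q.2) := by fun_prop
  have hV₁ : ContinuousOn V₁ (univ ×ˢ Iic 0) := hexp.continuousOn.mul h₁.continuousOn
  have hV₂ : ContinuousOn V₂ (univ ×ˢ Iic 0) := hexp.continuousOn.mul h₂.continuousOn
  have hV : ∀ q, V₁ q - V₂ q = Real.exp (γ * q.2) * (W₁ q.1 q.2 - W₂ q.1 q.2) := fun q => by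
    simp only [V₁, V₂]; ring
  have hpos : 0 < V₁ (x₀, t₀) - V₂ (x₀, t₀) := by
    rw [hV]
    exact mul_pos (Real.exp_pos _) (sub_pos.2 hlt)
  -- This makes $V_1-V_2-\psi$ equal to $\eta$ at $(x_0,t_0)$, because $\psi(x_0,t_0)=-\eta t_0$.
  set η : ℝ := (V₁ (x₀, t₀) - V₂ (x₀, t₀)) / (1 - t₀) with hη
  have hη0 : 0 < η := div_pos hpos (by linarith)
  have hηeq : η * (1 - t₀) = V₁ (x₀, t₀) - V₂ (x₀, t₀) :=
    div_mul_cancel₀ _ (by linarith)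
  -- The radius at which the lateral barrier is fully active at time 0, hence sufficient at all
  -- earlier times.
  set R : ℝ := M * -t₀ + 3 with hR
  have hMt : 0 ≤ M * -t₀ := mul_nonneg hM (by linarith)
  set S : Set (E n × ℝ) := Metric.closedBall x₀ R ×ˢ Icc (t₀ - 1) 0 with hSdef
  have hS : IsCompact S := (isCompact_closedBall x₀ R).prod isCompact_Icc
  have hS0 : S ⊆ univ ×ˢ Iic 0 := fun q hq => ⟨mem_univ _, hq.2.2⟩
  have hmem : (x₀, t₀) ∈ S := ⟨Metric.mem_closedBall_self (by linarith), by linarith, ht₀⟩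
  obtain ⟨A, hA⟩ := hS.exists_bound_of_continuousOn ((hV₁.sub hV₂).mono hS0)
  have hAle : ∀ q ∈ S, V₁ q - V₂ q ≤ A := fun q hq => (le_abs_self _).trans (hA q hq)
  obtain ⟨ψ, hψ, hψ', hψ0, hψle, hψx, hψt⟩ :=
    exists_penalty x₀ t₀ (M := M) ((norm_nonneg _).trans (hA _ hmem)) η
  have hdcont : Continuous fun P : (E n × ℝ) × (E n × ℝ) =>
      ‖P.1.1 - P.2.1‖ ^ 2 + (P.1.2 - P.2.2) ^ 2 := by fun_prop
  obtain ⟨z, hzS, hzmax, hz⟩ := exists_doubling hS ⟨_, hmem⟩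
    (v := fun q => V₁ q - ψ q) (w := V₂)
    ((hV₁.mono hS0).sub hψ.continuous.continuousOn) (hV₂.mono hS0)
    (d := fun p q => ‖p.1 - q.1‖ ^ 2 + (p.2 - q.2) ^ 2) hdcont (fun p q => by positivity)
    (fun p => by simp) (fun p q h => by
      have h1 : ‖p.1 - q.1‖ ^ 2 = 0 := by nlinarith [sq_nonneg ‖p.1 - q.1‖, sq_nonneg (p.2 - q.2)]
      have h2 : (p.2 - q.2) ^ 2 = 0 := by nlinarith [sq_nonneg ‖p.1 - q.1‖]
      exact Prod.ext (sub_eq_zero.1 (norm_eq_zero.1 (pow_eq_zero_iff two_ne_zero |>.1 h1)))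
        (sub_eq_zero.1 (pow_eq_zero_iff two_ne_zero |>.1 h2)))
  have hzpos : 0 < V₁ z - ψ z - V₂ z := by
    have h1 := hzmax _ hmem
    simp only [hψ0] at h1
    linarith
  have hηz : η * z.2 ≤ 0 := mul_nonpos_of_nonneg_of_nonpos hη0.le hzS.2.2
  -- At time 0 the terminal inequality and $\psi\ge0$ exclude a positive maximum. On the other
  -- boundary parts $\psi\ge A-\eta t$ while $V_1-V_2\le A$.
  have hz0 : z.2 < 0 := by
    refine lt_of_le_of_ne hzS.2.2 fun h => ?_
    have h1 := hV z
    rw [h, mul_zero, Real.exp_zero, one_mul] at h1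
    linarith [hψle z, h0 z.1]
  have hzt : t₀ - 1 < z.2 := by
    by_contra! h
    linarith [hψt z h, hAle z hzS]
  have hzx : ‖z.1 - x₀‖ < R := by
    by_contra! h
    have : M * (z.2 - t₀) + 3 ≤ ‖z.1 - x₀‖ := by
      refine le_trans ?_ h
      rw [hR]
      nlinarith
    linarith [hψx z this, hAle z hzS]
  set O : Set (E n × ℝ) := Metric.ball x₀ R ×ˢ Ioo (t₀ - 1) 0 with hOdef
  have hO : IsOpen O := Metric.isOpen_ball.prod isOpen_Ioo
  have hOS : O ⊆ S := prod_mono Metric.ball_subset_closedBall Ioo_subset_Icc_self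
  have hzO : z ∈ O := ⟨by rwa [Metric.mem_ball, dist_eq_norm], hzt, hz0⟩
  have hWz : W₂ z.1 z.2 < W₁ z.1 z.2 := by
    have h1 : 0 < V₁ z - V₂ z := by linarith [hψle z]
    rw [hV] at h1
    exact sub_pos.1 (pos_of_mul_pos_right h1 (Real.exp_nonneg _))
  have hO0 : univ ×ˢ Iic 0 ∈ nhds z := Filter.mem_of_superset (hO.mem_nhds hzO) (hOS.trans hS0)
  have hlc : ContinuousAt (fun q : E n × ℝ => l q.1) z := by fun_prop
  -- Near `z` the level `a` separates $W_2-l$ from $W_1-l$. Hence $W_1\le l$ at `p` forces $a<0$,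
  -- and then $W_2<l$ at `q`, although the two points differ.
  obtain ⟨a, ha₂, ha₁⟩ := exists_between (sub_lt_sub_right hWz (l z.1))
  have hN₁ := ((h₁.continuousOn.continuousAt hO0).sub hlc).eventually (lt_mem_nhds ha₁)
  have hN₂ := ((h₂.continuousOn.continuousAt hO0).sub hlc).eventually (gt_mem_nhds ha₂)
  obtain ⟨k, hk, p, ⟨⟨hpO, hp₁, -⟩, -⟩, q, ⟨⟨hqO, -, hq₂⟩, -⟩, hkd, hpq⟩ :=
    hz _ (Filter.inter_mem (hO.mem_nhds hzO) (Filter.inter_mem hN₁ hN₂)) (η / (2 * L + 1))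
      (by positivity)
  refine doubled_inequalities_false hf h₁ h₂ hψ hψ' hk hpO.2.2 hqO.2.2 ?_ ?_ ?_ ?_
  · rw [lt_div_iff₀ (by positivity)] at hkd
    have : 0 ≤ k * (‖p.1 - q.1‖ ^ 2 + (p.2 - q.2) ^ 2) := by positivity
    linarith
  · filter_upwards [hO.mem_nhds hpO] with p' hp'
    have := hpq p' (hOS hp') q (hOS hqO)
    simp only [V₁] at this
    linarith
  · filter_upwards [hO.mem_nhds hqO] with q' hq'
    have := hpq p (hOS hpO) q' (hOS hq')
    simp only [V₂] at this
    rw [norm_sub_rev q.1, norm_sub_rev q'.1, sub_sq_comm q.2, sub_sq_comm q'.2]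
    linarith
  · intro h
    have h1 : a < W₁ p.1 p.2 - l p.1 := hp₁
    have h2 : W₂ q.1 q.2 - l q.1 < a := hq₂
    linarith

end CBVF

/-! ### The main theorem -/

theorem mainTheorem1 {n m w : ℕ}
    (U : Set (CBVF.E m)) (D : Set (CBVF.E w))
    (hU : IsCompact U) (hU_ne : U.Nonempty) (hD : IsCompact D) (hD_ne : D.Nonempty)
    (f : CBVF.E n → CBVF.E m → CBVF.E w → CBVF.E n)
    (hf_lip : ∃ L : NNReal, ∀ u ∈ U, ∀ d ∈ D, LipschitzWith L (fun x => f x u d))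
    (hf_bdd : ∃ M : ℝ, ∀ x, ∀ u ∈ U, ∀ d ∈ D, ‖f x u d‖ ≤ M)
    (hf_cont : ∀ x, ContinuousOn (fun p : CBVF.E m × CBVF.E w => f x p.1 p.2) (U ×ˢ D))
    (l : CBVF.E n → ℝ)
    (hl_lip : ∃ L : NNReal, LipschitzWith L l) (hl_bdd : ∃ M : ℝ, ∀ x, |l x| ≤ M)
    (γ : ℝ) (hγ : 0 ≤ γ) :
    (∀ T : ℝ, ∃ K : NNReal,
      LipschitzOnWith K (fun p : CBVF.E n × ℝ => CBVF.value f U D l γ p.1 p.2)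
        (Set.univ ×ˢ Set.Icc T 0)) ∧
    CBVF.IsViscositySolution f U D l γ (CBVF.value f U D l γ) ∧
    (∀ x, CBVF.value f U D l γ x 0 = l x) ∧
    (∀ W : CBVF.E n → ℝ → ℝ, CBVF.IsViscositySolution f U D l γ W → (∀ x, W x 0 = l x) →
      ∀ x, ∀ t ≤ 0, W x t = CBVF.value f U D l γ x t) := by
  obtain ⟨L, hL⟩ := hf_lip
  obtain ⟨M, hM⟩ := hf_bdd
  obtain ⟨K, hK⟩ := hl_lip
  obtain ⟨C, hC⟩ := hl_bdd
  have hp : CBVF.RegularProblem f U D l γ L M K C :=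
    { isCompact_left := hU
      nonempty_left := hU_ne
      isCompact_right := hD
      nonempty_right := hD_ne
      lipschitz := hL
      norm_le := hM
      continuousOn := hf_cont
      lipschitz_cost := hK
      abs_cost_le := hC
      rate_nonneg := hγ }
  have hf := hp.toRegularDynamics
  refine ⟨hp.exists_lipschitzOnWith_value, hp.isViscositySolution_value, hp.value_zero,
    fun W hW hW0 x t ht => le_antisymm ?_ ?_⟩
  -- Uniqueness is comparison applied in both directions, with equal terminal data.
  · exact hW.le_of_terminal_le hf hK.continuous hp.isViscositySolution_value
      (fun x => by rw [hW0, hp.value_zero]) x ht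
  · exact hp.isViscositySolution_value.le_of_terminal_le hf hK.continuous hW
      (fun x => by rw [hW0, hp.value_zero]) x ht
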